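/- Let $n\ge 1$ and let $E=\mathbb{C}^{2n}$ have basis $e_1,\dots,e_{2n}$. Let $pr_k:E\to E$ be the linear map with $pr_k e_k=0$ and $pr_ke_l=e_l$ for $l\ne k$, and let $(\cdot,\cdot)$ be the symplectic form with $(e_k,e_{2n+1-k})=1$ for $1\le k\le n$ and $(e_k,e_l)=0$ for $k+l\ne 2n+1$. For $1\le k\le n$ order $\{1,\dots,2n\}$ by $$k>_k k-1>_k\dots>_k 1>_k 2n>_k 2n-1>_k\dots>_k k+1.$$ Let $F^a_{\mathbf d}$ be the variety of collections $(V_1,\dots,V_n)$ of subspaces of $E$ with $\dim V_k=k$ and $pr_{k+1}V_k\subset V_{k+1}$ for $1\le k<n$, and let $SpF^a_{2n}\subset F^a_{\mathbf d}$ be the subvariety on which $V_n$ is Lagrangian. Let $\mathcal{I}_{2n}$ be the set of collections $\mathbf I=(I_1,\dots,I_n)$ of subsets of $\{1,\dots,2n\}$ such that $|I_k|=k$, $I_k\subset I_{k+1}\cup\{k+1\}$ for $1\le k<n$, and $a\in I_n$ implies $2n+1-a\notin I_n$. For $\mathbf I\in\mathcal I_{2n}$ let $C_A(\mathbf I)\subset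 F^a_{\mathbf d}$ be the set of $(V_1,\dots,V_n)$ such that every $V_k$ has a basis of the form $e_i+\sum_{b<_k i,\ b\notin I_k}x_{i,b}e_b$, $i\in I_k$, with $x_{i,b}\in\mathbb C$, and let $C(\mathbf I)=SpF^a_{2n}\cap C_A(\mathbf I)$. For $a,b\in\{1,\dots,2n\}$ put $s(a,b,k)=1$ if $a,b\ge_k 2n-k+1$ and $2n+1-b<_k a$, and $s(a,b,k)=0$ otherwise. Put $I_0=\emptyset$, $d_0=0$, and define $d_1,\dots,d_n$ inductively as follows. If $k\notin I_{k-1}$, then $I_k\setminus I_{k-1}=\{j\}$ and $$d_k=d_{k-1}+|\{x: x<_k j,\ x\notin I_{k-1}\}|-\sum_{i\in I_{k-1}}s(j,i,k).$$ If $k\in I_{k-1}$, let $I'_{k-1}=I_{k-1}\setminus\{k\}$ and $I_k\setminus I'_{k-1}=\{j_1,j_2\}$ with $j_1>_k j_2$; then $$d_k=d_{k-1}+|\{x: x<_k j_2,\ x\notin I'_{k-1}\}|+|\{x:x<_k j_1,\ x\notin I'_{k-1}\}|-1-s(j_1,j_2,k)-\sum_{i\in I'_{k-1}}\bigl(s(j_1,i,k)+s(j_2,i,k)\bigr).$$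 Theorem. For every $\mathbf I\in\mathcal I_{2n}$ the dimension of $C(\mathbf I)$ (as a locally closed subvariety of $\prod_{k=1}^n\mathrm{Gr}(k,2n)$) is $d_n$. Moreover, let $ID_k$ be the set of $l\in I_k$ with $l=k$ or $l\notin I_{k-1}$ (the initiating disks $[k:l]$ of column $k$), and for $l\in ID_k$ let $w(k:l)=|\{x: x<_k l,\ x\notin I_k\}|$. Then for all $1\le k\le n$ $$d_k=d_{k-1}+\sum_{l\in ID_k}\Bigl(w(k:l)-\sum_{l'}s(l,l',k)\Bigr),$$ where the inner sum is over all $l'\in I_k$ such that $l'<_k l$ or $l'\notin ID_k$. -/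

import Mathlib

namespace DegFlag

/-- The set of labels `{1, …, N}`. -/
abbrev Idx (N : ℕ) : Type := {i : ℕ // i ∈ Finset.Icc 1 N}

/-- The complex vector space with basis `e_1, …, e_N`. -/
abbrev E (N : ℕ) : Type := Idx N → ℂ

/-- The basis vector `e_i`. -/
def e {N : ℕ} (i : Idx N) : E N := Pi.single i 1

/-- The projection `pr_k` along `e_k`: it kills `e_k` and fixes every other basis vector. -/
def pr {N : ℕ} (k : ℕ) : E N →ₗ[ℂ] E N where
  toFun v := fun i => if (i : ℕ) = k then 0 else v i
  map_add' u v := by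
    funext i
    by_cases h : (i : ℕ) = k <;> simp [h]
  map_smul' c v := by
    funext i
    by_cases h : (i : ℕ) = k <;> simp [h]

/-- The ordering `a <_k b`, where
`k+1 <_k k+2 <_k ⋯ <_k N <_k 1 <_k 2 <_k ⋯ <_k k`. -/
def Lt (k a b : ℕ) : Prop :=
  (k < a ∧ b ≤ k) ∨ (k < a ∧ k < b ∧ a < b) ∨ (a ≤ k ∧ b ≤ k ∧ a < b)

instance (k a b : ℕ) : Decidable (Lt k a b) := by
  unfold Lt
  infer_instance

/-! ### Products of Grassmannians and their Zariski topology -/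

/-- The Grassmannian of `k`-dimensional subspaces of `ℂ^N`. -/
def Gr (k N : ℕ) : Type := {V : Submodule ℂ (E N) // Module.finrank ℂ V = k}

/-- The product `Gr(1,N) × ⋯ × Gr(n,N)`. -/
def GrProd (n N : ℕ) : Type := ∀ k : Idx n, Gr k N

/-- The `k`-th component `V_k` of a point of the product. -/
def GrProd.sub {n N : ℕ} (V : GrProd n N) (k : Idx n) : Submodule ℂ (E N) := (V k).1

/-- The Zariski topology on the affine space `ℂ^σ`: the complements of the hypersurfaces
form a base of open sets. -/
@[reducible] def zariski (σ : Type) : TopologicalSpace (σ → ℂ) :=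
  TopologicalSpace.generateFrom
    {U | ∃ p : MvPolynomial σ ℂ, U = {x | MvPolynomial.eval x p ≠ 0}}

/-- Tuples of matrices, the `k`-th of size `k × N`. -/
abbrev MatTuple (n N : ℕ) : Type := (Σ k : Idx n, Fin (k : ℕ) × Idx N) → ℂ

/-- The `i`-th row of the `k`-th matrix. -/
def MatTuple.row {n N : ℕ} (x : MatTuple n N) (k : Idx n) (i : Fin (k : ℕ)) : E N :=
  fun b => x ⟨k, i, b⟩

/-- Tuples of matrices of full rank. -/
def Frames (n N : ℕ) : Type :=
  {x : MatTuple n N // ∀ k : Idx n, LinearIndependent ℂ (x.row k)}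

/-- A tuple of full rank matrices is sent to the tuple of their row spaces. -/
def Frames.span {n N : ℕ} (x : Frames n N) : GrProd n N := fun k =>
  ⟨Submodule.span ℂ (Set.range (x.1.row k)), by
    rw [finrank_span_eq_card (x.2 k), Fintype.card_fin]⟩

/-- The Zariski topology on the product of Grassmannians, that is, on the quotient of the
Zariski open set of tuples of full rank matrices by `GL_1 × ⋯ × GL_n`. -/
instance (n N : ℕ) : TopologicalSpace (GrProd n N) :=
  TopologicalSpace.coinduced (Frames.span : Frames n N → GrProd n N)
    (TopologicalSpace.induced Subtype.val (zariski (Σ k : Idx n, Fin (k : ℕ) × Idx N)))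

/-! ### Degenerate flag varieties and their cells -/

/-- The partial degenerate flag variety `F^a_d` of type `A`, `d = (1, …, n)`: collections
`(V_1, …, V_n)` with `pr_{k+1} V_k ⊆ V_{k+1}`. (For `n < N` each of them extends to a point of
the complete degenerate flag variety, so this is the projection of the latter.) -/
def flagA (n N : ℕ) : Set (GrProd n N) :=
  {V | ∀ k k' : Idx n, (k' : ℕ) = k + 1 → (V.sub k).map (pr (k + 1)) ≤ V.sub k'}

/-- The Gram matrix of the symplectic form on `ℂ^{2n}`: `(e_k, e_{2n+1-k}) = 1` for `k ≤ n`,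
`= -1` for `k > n`, and `(e_k, e_l) = 0` for `k + l ≠ 2n + 1`. -/
def gram (n : ℕ) : Matrix (Idx (2 * n)) (Idx (2 * n)) ℂ := fun k l =>
  if (k : ℕ) + l = 2 * n + 1 then (if (k : ℕ) ≤ n then 1 else -1) else 0

/-- The symplectic form on `ℂ^{2n}`. -/
def form {n : ℕ} (u v : E (2 * n)) : ℂ := u ⬝ᵥ (gram n).mulVec v

/-- The symplectic degenerate flag variety `SpF^a_{2n}`. The space `V_n` has dimension `n`, so it
is Lagrangian if and only if the form vanishes on it. -/
def spFlag (n : ℕ) : Set (GrProd n (2 * n)) :=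
  {V | (∀ k k' : Idx n, (k' : ℕ) = k + 1 → (V.sub k).map (pr (k + 1)) ≤ V.sub k') ∧
    ∀ k : Idx n, (k : ℕ) = n → ∀ u ∈ V.sub k, ∀ v ∈ V.sub k, form u v = 0}

/-- A collection `(I_1, …, I_n)` of subsets of `{1, …, N}`. -/
abbrev Coll (n N : ℕ) : Type := Idx n → Finset (Idx N)

/-- The set `𝓘_{2n}` of collections with `|I_k| = k`, `I_k ⊆ I_{k+1} ∪ {k+1}`, and
`2n+1-a ∉ I_n` whenever `a ∈ I_n`. -/
def admissible (n : ℕ) : Set (Coll n (2 * n)) :=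
  {I | (∀ k, (I k).card = k) ∧
    (∀ k k' : Idx n, (k' : ℕ) = k + 1 → ∀ a ∈ I k, a ∈ I k' ∨ (a : ℕ) = k + 1) ∧
    ∀ k : Idx n, (k : ℕ) = n → ∀ a ∈ I k, ∀ b ∈ I k, (a : ℕ) + b ≠ 2 * n + 1}

/-- The cell `C_A(I)` of `F^a_d`: every `V_k` has a basis of the form
`e_i + ∑_{b <_k i, b ∉ I_k} x_{i,b} e_b`, `i ∈ I_k`. -/
def cellA {n N : ℕ} (I : Coll n N) : Set (GrProd n N) :=
  {V | V ∈ flagA n N ∧ ∀ k : Idx n, ∃ (x : Idx N → Idx N → ℂ)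
    (B : Module.Basis {i // i ∈ I k} ℂ (V.sub k)), ∀ i : {i // i ∈ I k},
      (B i : E N) = e i.1 +
        ∑ b ∈ Finset.univ.filter (fun b : Idx N => Lt k b i.1 ∧ b ∉ I k),
          x i.1 b • e b}

/-- The cell `C(I) = SpF^a_{2n} ∩ C_A(I)`. -/
def cell {n : ℕ} (I : Coll n (2 * n)) : Set (GrProd n (2 * n)) := spFlag n ∩ cellA I

/-! ### The algorithm -/

/-- The set `I_k`, with `I_k = ∅` if `k = 0` (or `k > n`). -/
def col {n N : ℕ} (I : Coll n N) (k : ℕ) : Finset (Idx N) :=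
  if h : k ∈ Finset.Icc 1 n then I ⟨k, h⟩ else ∅

/-- `s(a,b,k)` is `1` if `a, b ≥_k 2n-k+1` and `2n+1-b <_k a`, and `0` otherwise. -/
def s {n : ℕ} (a b : Idx (2 * n)) (k : ℕ) : ℤ :=
  if ¬ Lt k a (2 * n - k + 1) ∧ ¬ Lt k b (2 * n - k + 1) ∧ Lt k (2 * n + 1 - b) a then 1 else 0

/-- The number of `x ∈ {1, …, N}` with `x <_k j` and `x ∉ A`. -/
def below {N : ℕ} (k : ℕ) (j : Idx N) (A : Finset (Idx N)) : ℤ :=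
  (Finset.univ.filter fun x : Idx N => Lt k x j ∧ x ∉ A).card

/-- The set `I'_{k-1} = I_{k-1} \ {k}` of labels kept at step `k`. -/
def kept {n N : ℕ} (I : Coll n N) (k : ℕ) : Finset (Idx N) :=
  (col I (k - 1)).filter fun x => (x : ℕ) ≠ k

/-- The number added at step `k`. If no element of `I_{k-1}` is equal to `k`, then
`I_k \ I_{k-1}` is a singleton `{j}` and the outer sum is over this `j`. Otherwise
`I_k \ I'_{k-1}` is a pair `{j_1, j_2}` with `j_1 >_k j_2`, and the outer sum is over the
single ordered pair `p = (j_1, j_2)`. -/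
def increment {n : ℕ} (I : Coll n (2 * n)) (k : ℕ) : ℤ :=
  if ∀ x ∈ col I (k - 1), (x : ℕ) ≠ k then
    ∑ j ∈ col I k \ col I (k - 1),
      (below k j (col I (k - 1)) - ∑ i ∈ col I (k - 1), s j i k)
  else
    ∑ p ∈ ((col I k \ kept I k) ×ˢ (col I k \ kept I k)) with Lt k p.2 p.1,
      (below k p.2 (kept I k) + below k p.1 (kept I k) - 1 - s p.1 p.2 k
        - ∑ i ∈ kept I k, (s p.1 i k + s p.2 i k))

/-- The numbers `d_0 = 0, d_1, …, d_n` produced by the inductive algorithm. -/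
def d {n : ℕ} (I : Coll n (2 * n)) : ℕ → ℤ
  | 0 => 0
  | k + 1 => d I k + increment I (k + 1)

/-- The labels `l` of the initiating disks `[k:l]` of column `k`: `l ∈ I_k`, and either `l = k`
or `l ∉ I_{k-1}`. -/
def initiating {n N : ℕ} (I : Coll n N) (k : ℕ) : Finset (Idx N) :=
  (col I k).filter fun l => (l : ℕ) = k ∨ l ∉ col I (k - 1)

/-- The number `w(k:l)` of white disks of column `k` located under the disk `[k:l]`. -/
def white {n N : ℕ} (I : Coll n N) (k : ℕ) (l : Idx N) : ℤ := below k l (col I k)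

end DegFlag

/-! The cell is homeomorphic, for the Zariski topology, to an affine space whose coordinates are
indexed by `freeEntries`. Its dimension is therefore the number of free entries, and a count shows
that this number is `d I n`.

Geometry. A point of the cell is a tuple of matrices `R k`, with rows indexed by `I_k`, reduced on
the columns `I_k` and triangular for `<_k`. Membership in the cell becomes equations on their
entries (`mem_cell_iff`). The Lagrangian condition on `V_n` pairs the entry `(i, b)` with `(dual b,
dual i)` up to sign, so one entry of each such pair is free. The condition `pr_{k+1} V_k ⊆ V_{k+1}`
determines the entries of `R k` in all columns outside `I_{k+1} ∪ {k+1}` from `R (k+1)` and the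
other entries of `R k`; the non-pivot entries below `i` in the columns of `I_{k+1} ∪ {k+1}` are
free. Solving downwards from `k = n` gives a polynomial parametrization (`IsSolution.eq_eval`,
`solution_isSolution`). It is open onto the cell because its parameters are among the normalized
matrix entries, which are regular on an affine chart of the Grassmannians (`isOpenMap_cellMap`).
Affine space has the expected dimension by the Nullstellensatz and the Krull dimension of polynomial
rings (`topologicalKrullDim_zspace`).

Combinatorics. The algorithm goes upwards in `k`, whereas the parametrization goes downwards. The
closed formula `d_eq` reconciles the two. It rests on `increment_eq_diskSum`, which is also the
second claim of the theorem. -/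

namespace DegFlag

/-! ### Affine space with the Zariski topology -/

/-- The affine space `ℂ^σ`, carrying the Zariski topology. -/
def ZSpace (σ : Type) : Type := σ → ℂ

instance (σ : Type) : TopologicalSpace (ZSpace σ) := zariski σ

/-- The complement of a hypersurface. -/
def basicOpen {σ : Type} (p : MvPolynomial σ ℂ) : Set (ZSpace σ) :=
  {x | MvPolynomial.eval (σ := σ) x p ≠ 0}

theorem mem_basicOpen {σ : Type} {p : MvPolynomial σ ℂ} {x : ZSpace σ} :
    x ∈ basicOpen p ↔ MvPolynomial.eval (σ := σ) x p ≠ 0 := Iff.rfl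

theorem mem_basicOpen_mul {σ : Type} {p q : MvPolynomial σ ℂ} {x : ZSpace σ} :
    x ∈ basicOpen (p * q) ↔ x ∈ basicOpen p ∧ x ∈ basicOpen q := by
  rw [mem_basicOpen, map_mul, mul_ne_zero_iff]
  rfl

theorem mem_vanishingIdeal {σ : Type} {p : MvPolynomial σ ℂ} {Z : Set (ZSpace σ)} :
    p ∈ MvPolynomial.vanishingIdeal ℂ Z ↔ ∀ x ∈ Z, x ∉ basicOpen p := by
  simp only [mem_basicOpen, not_not]
  rfl

theorem mem_zeroLocus {σ : Type} {J : Ideal (MvPolynomial σ ℂ)} {x : ZSpace σ} :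
    x ∈ (MvPolynomial.zeroLocus ℂ J : Set (ZSpace σ)) ↔ ∀ p ∈ J, x ∉ basicOpen p := by
  simp only [mem_basicOpen, not_not]
  rfl

theorem isTopologicalBasis_basicOpen (σ : Type) :
    TopologicalSpace.IsTopologicalBasis (Set.range (basicOpen (σ := σ))) := by
  have h : (Set.range (basicOpen (σ := σ))) =
      {U | ∃ p : MvPolynomial σ ℂ, U = {x | MvPolynomial.eval x p ≠ 0}} := by
    ext U
    exact ⟨fun ⟨p, hp⟩ => ⟨p, hp.symm⟩, fun ⟨p, hp⟩ => ⟨p, hp.symm⟩⟩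
  refine ⟨?_, ?_, by rw [h]; rfl⟩
  · rintro _ ⟨p, rfl⟩ _ ⟨q, rfl⟩ x hx
    exact ⟨_, ⟨p * q, rfl⟩, mem_basicOpen_mul.2 hx, fun y hy => mem_basicOpen_mul.1 hy⟩
  · refine Set.eq_univ_of_forall fun x => ⟨_, ⟨1, rfl⟩, ?_⟩
    simp [mem_basicOpen]

theorem isOpen_basicOpen {σ : Type} (p : MvPolynomial σ ℂ) : IsOpen (basicOpen p) :=
  (isTopologicalBasis_basicOpen σ).isOpen ⟨p, rfl⟩

theorem isClosed_zeroLocus {σ : Type} (J : Ideal (MvPolynomial σ ℂ)) :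
    IsClosed (X := ZSpace σ) (MvPolynomial.zeroLocus ℂ J) := by
  have h (Z : Set (ZSpace σ)) (hZ : ∀ x, x ∈ Z ↔ ∀ p ∈ J, x ∉ basicOpen p) : IsClosed Z := by
    have hZ' : Z = ⋂ p ∈ J, (basicOpen p)ᶜ := by
      ext x
      simp only [hZ, Set.mem_iInter, Set.mem_compl_iff]
    rw [hZ']
    exact isClosed_biInter fun p _ => (isOpen_basicOpen p).isClosed_compl
  exact h _ fun x => mem_zeroLocus

theorem zeroLocus_vanishingIdeal_of_isClosed {σ : Type} {Z : Set (ZSpace σ)} (hZ : IsClosed Z) :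
    MvPolynomial.zeroLocus ℂ (MvPolynomial.vanishingIdeal ℂ Z) = Z := by
  refine Set.Subset.antisymm (fun x hx => ?_) (MvPolynomial.zeroLocus_vanishingIdeal_le Z)
  by_contra hxZ
  obtain ⟨_, ⟨p, rfl⟩, hxp, hp⟩ :=
    (isTopologicalBasis_basicOpen σ).exists_subset_of_mem_open hxZ hZ.isOpen_compl
  exact mem_zeroLocus.1 hx p (mem_vanishingIdeal.2 fun y hy hyp => hp hyp hy) hxp

theorem isPrime_vanishingIdeal {σ : Type} {Z : Set (ZSpace σ)} (hZ : IsIrreducible Z) :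
    (MvPolynomial.vanishingIdeal ℂ Z).IsPrime := by
  refine ⟨?_, ?_⟩
  · obtain ⟨x, hx⟩ := hZ.1
    intro h
    have h1 : (1 : MvPolynomial σ ℂ) ∈ MvPolynomial.vanishingIdeal ℂ Z := h ▸ Submodule.mem_top
    exact mem_vanishingIdeal.1 h1 x hx (by simp [mem_basicOpen])
  · intro p q hpq
    by_contra! h
    simp only [mem_vanishingIdeal, not_forall, not_not] at h
    obtain ⟨⟨x, hx, hxp⟩, ⟨y, hy, hyq⟩⟩ := h
    obtain ⟨z, hz, hzpq⟩ := hZ.2 _ _ (isOpen_basicOpen p) (isOpen_basicOpen q)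
      ⟨x, hx, hxp⟩ ⟨y, hy, hyq⟩
    exact mem_vanishingIdeal.1 hpq z hz (mem_basicOpen_mul.2 hzpq)

theorem isIrreducible_zeroLocus {σ : Type} [Finite σ] (P : Ideal (MvPolynomial σ ℂ))
    [hP : P.IsPrime] : IsIrreducible (X := ZSpace σ) (MvPolynomial.zeroLocus ℂ P) := by
  -- By the Nullstellensatz, a polynomial lies in the prime `P` exactly when it vanishes on the zero
  -- locus; primality then makes two nonempty basic opens meet.
  have key : ∀ p : MvPolynomial σ ℂ,
      p ∉ P ↔ ∃ x ∈ (MvPolynomial.zeroLocus ℂ P : Set (ZSpace σ)), x ∈ basicOpen p := by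
    intro p
    have h := mem_vanishingIdeal (p := p) (Z := MvPolynomial.zeroLocus ℂ P)
    rw [MvPolynomial.IsPrime.vanishingIdeal_zeroLocus P] at h
    rw [h]
    simp only [not_forall, not_not, exists_prop]
    exact Iff.rfl
  refine ⟨?_, ?_⟩
  · obtain ⟨x, hx, -⟩ := (key 1).1 ((Ideal.ne_top_iff_one P).1 hP.ne_top)
    exact ⟨x, hx⟩
  rintro U V hU hV ⟨x, hx, hxU⟩ ⟨y, hy, hyV⟩
  obtain ⟨_, ⟨p, rfl⟩, hxp, hp⟩ :=
    (isTopologicalBasis_basicOpen σ).exists_subset_of_mem_open hxU hU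
  obtain ⟨_, ⟨q, rfl⟩, hyq, hq⟩ :=
    (isTopologicalBasis_basicOpen σ).exists_subset_of_mem_open hyV hV
  have hpq : p * q ∉ P := fun h =>
    (hP.mem_or_mem h).elim (fun h => (key p).2 ⟨x, hx, hxp⟩ h)
      (fun h => (key q).2 ⟨y, hy, hyq⟩ h)
  obtain ⟨z, hz, hzpq⟩ := (key _).1 hpq
  exact ⟨z, hz, hp (mem_basicOpen_mul.1 hzpq).1, hq (mem_basicOpen_mul.1 hzpq).2⟩

/-- The Nullstellensatz: irreducible closed subsets of affine space are prime ideals. -/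
noncomputable def irreducibleClosedsEquiv (σ : Type) [Finite σ] :
    TopologicalSpace.IrreducibleCloseds (ZSpace σ) ≃o (PrimeSpectrum (MvPolynomial σ ℂ))ᵒᵈ where
  toFun Z := OrderDual.toDual
    ⟨MvPolynomial.vanishingIdeal ℂ (Z : Set (ZSpace σ)), isPrime_vanishingIdeal Z.isIrreducible⟩
  invFun P := ⟨MvPolynomial.zeroLocus ℂ (OrderDual.ofDual P).asIdeal,
    haveI := (OrderDual.ofDual P).isPrime
    isIrreducible_zeroLocus _, isClosed_zeroLocus _⟩
  left_inv Z := SetLike.coe_injective (zeroLocus_vanishingIdeal_of_isClosed Z.isClosed)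
  right_inv P := by
    have := (OrderDual.ofDual P).isPrime
    exact congrArg OrderDual.toDual (PrimeSpectrum.ext
      (MvPolynomial.IsPrime.vanishingIdeal_zeroLocus (OrderDual.ofDual P).asIdeal))
  map_rel_iff' := by
    intro Z W
    refine ⟨fun h => ?_, fun h => ?_⟩
    · have h' := MvPolynomial.zeroLocus_anti_mono (K := ℂ) h
      have hZ := zeroLocus_vanishingIdeal_of_isClosed Z.isClosed
      have hW := zeroLocus_vanishingIdeal_of_isClosed W.isClosed
      exact (hZ.symm.subset.trans h').trans hW.subset
    · exact MvPolynomial.vanishingIdeal_anti_mono h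

theorem topologicalKrullDim_zspace (σ : Type) [Finite σ] :
    topologicalKrullDim (ZSpace σ) = ((Nat.card σ : ℕ∞) : WithBot ℕ∞) := by
  rw [topologicalKrullDim, Order.krullDim_eq_of_orderIso (irreducibleClosedsEquiv σ),
    Order.krullDim_orderDual, ← ringKrullDim, MvPolynomial.ringKrullDim_of_isNoetherianRing,
    ringKrullDim_eq_zero_of_field]
  simp

/-! ### Combinatorics of the algorithm -/

theorem Idx.one_le {N : ℕ} (a : Idx N) : 1 ≤ (a : ℕ) := (Finset.mem_Icc.1 a.2).1

theorem Idx.le {N : ℕ} (a : Idx N) : (a : ℕ) ≤ N := (Finset.mem_Icc.1 a.2).2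

theorem Lt.irrefl {k a : ℕ} : ¬ Lt k a a := by
  unfold Lt; omega

theorem Lt.total {k a b : ℕ} (h : a ≠ b) : Lt k a b ∨ Lt k b a := by
  unfold Lt; omega

theorem Lt.asymm {k a b : ℕ} (h : Lt k a b) : ¬ Lt k b a := by
  unfold Lt at *; omega

theorem Lt.trans {k a b c : ℕ} (h : Lt k a b) (h' : Lt k b c) : Lt k a c := by
  unfold Lt at *; omega

/-- Passing from `<_k` to `<_{k+1}` only moves the label `k+1` from the minimum to the maximum.
Every comparison of adjacent columns below uses this. -/
theorem lt_succ_iff {k a b : ℕ} (ha : a ≠ k + 1) (hb : b ≠ k + 1) :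
    Lt (k + 1) a b ↔ Lt k a b := by
  unfold Lt; omega

theorem not_lt_succ_self {k b : ℕ} : ¬ Lt k b (k + 1) := by
  unfold Lt; omega

theorem not_succ_lt {k b : ℕ} : ¬ Lt (k + 1) (k + 1) b := by
  unfold Lt; omega

/-- The window of labels `≥_k 2n-k+1` is `2n-k+1, …, 2n, 1, …, k`, and `a ↦ 2n+1-a` reverses it. -/
theorem s_comm {n k : ℕ} (hk : k ≤ n) (a b : Idx (2 * n)) : s a b k = s b a k := by
  have := a.one_le; have := a.le; have := b.one_le; have := b.le
  unfold s Lt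
  congr 1
  apply propext
  omega

/-- Besides `k+1`, the window gains only its new minimum `2n-k`, the dual of `k+1`; that label can
be involved in `s = 1` only together with `k+1`. -/
theorem s_succ {n k : ℕ} (hk : k < n) {a b : Idx (2 * n)} (ha : (a : ℕ) ≠ k + 1)
    (hb : (b : ℕ) ≠ k + 1) : s a b (k + 1) = s a b k := by
  have := a.one_le; have := a.le; have := b.one_le; have := b.le
  unfold s Lt
  congr 1
  apply propext
  omega

theorem s_eq_zero {n k : ℕ} {a : Idx (2 * n)} (b : Idx (2 * n))
    (ha : (a : ℕ) = k + 1) : s a b k = 0 := by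
  have := a.one_le; have := a.le
  unfold s Lt
  rw [if_neg]
  omega

theorem s_last {n : ℕ} (a b : Idx (2 * n)) :
    s a b n = if Lt n (2 * n + 1 - b) a then 1 else 0 := by
  have := a.one_le; have := a.le; have := b.one_le; have := b.le
  unfold s Lt
  congr 1
  apply propext
  omega

section Admissible

variable {n : ℕ} {I : Coll n (2 * n)}

theorem col_zero {N : ℕ} (I : Coll n N) : col I 0 = ∅ := by
  simp [col]

theorem col_eq {N : ℕ} (I : Coll n N) (k : Idx n) : col I k = I k := by
  simp only [col, k.2, dif_pos]

theorem card_col (hI : I ∈ admissible n) {k : ℕ} (hk : k ≤ n) : (col I k).card = k := by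
  rcases Nat.eq_zero_or_pos k with rfl | h0
  · simp [col_zero]
  · exact (congrArg _ (col_eq I ⟨k, Finset.mem_Icc.2 ⟨h0, hk⟩⟩)).trans (hI.1 _)

theorem mem_col_succ (hI : I ∈ admissible n) {k : ℕ} (hk : k < n) {a : Idx (2 * n)}
    (ha : a ∈ col I k) : a ∈ col I (k + 1) ∨ (a : ℕ) = k + 1 := by
  rcases Nat.eq_zero_or_pos k with rfl | h0
  · simp [col_zero] at ha
  · have h1 : k ∈ Finset.Icc 1 n := Finset.mem_Icc.2 ⟨h0, hk.le⟩
    have h2 : k + 1 ∈ Finset.Icc 1 n := Finset.mem_Icc.2 ⟨by omega, hk⟩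
    rw [col, dif_pos h1] at ha
    rw [col, dif_pos h2]
    exact hI.2.1 ⟨k, h1⟩ ⟨k + 1, h2⟩ rfl a ha

theorem add_ne_of_mem_col (hI : I ∈ admissible n) {a b : Idx (2 * n)}
    (ha : a ∈ col I n) (hb : b ∈ col I n) : (a : ℕ) + b ≠ 2 * n + 1 := by
  have h1 : n ∈ Finset.Icc 1 n := by
    have := a.one_le; have := a.le
    exact Finset.mem_Icc.2 ⟨by omega, le_rfl⟩
  rw [col, dif_pos h1] at ha hb
  exact hI.2.2 ⟨n, h1⟩ rfl a ha b hb

/-- The label `2n+1-a` paired with `a` by the symplectic form. -/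
def dual (a : Idx (2 * n)) : Idx (2 * n) :=
  ⟨2 * n + 1 - a, Finset.mem_Icc.2 ⟨by have := a.le; omega, by have := a.one_le; omega⟩⟩

@[simp] theorem coe_dual (a : Idx (2 * n)) : (dual a : ℕ) = 2 * n + 1 - a := rfl

@[simp] theorem dual_dual (a : Idx (2 * n)) : dual (dual a) = a := by
  apply Subtype.ext
  have := a.one_le; have := a.le
  simp only [coe_dual]; omega

theorem add_eq_iff_eq_dual {a b : Idx (2 * n)} : (a : ℕ) + b = 2 * n + 1 ↔ b = dual a := by
  rw [Subtype.ext_iff, coe_dual]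
  have := a.one_le; have := a.le
  omega

/-- `I_n` and its image under `dual` are disjoint sets of `n` labels, hence they partition the `2n`
labels. -/
theorem dual_mem_col_iff (hI : I ∈ admissible n) (a : Idx (2 * n)) :
    dual a ∈ col I n ↔ a ∉ col I n := by
  have hinj : Function.Injective (dual (n := n)) :=
    Function.LeftInverse.injective (g := dual) dual_dual
  have hdisj : Disjoint (col I n) ((col I n).image dual) := by
    rw [Finset.disjoint_left]
    intro x hx hx'
    obtain ⟨y, hy, rfl⟩ := Finset.mem_image.1 hx'
    exact add_ne_of_mem_col hI hy hx (add_eq_iff_eq_dual.2 rfl)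
  have huniv : col I n ∪ (col I n).image dual = Finset.univ := by
    apply Finset.eq_univ_of_card
    rw [Finset.card_union_of_disjoint hdisj, Finset.card_image_of_injective _ hinj,
      card_col hI le_rfl, Fintype.card_coe, Nat.card_Icc]
    omega
  constructor
  · intro h h'
    exact add_ne_of_mem_col hI h' h (add_eq_iff_eq_dual.2 rfl)
  · intro h
    have := huniv ▸ Finset.mem_univ a
    rcases Finset.mem_union.1 this with h' | h'
    · exact absurd h' h
    · obtain ⟨y, hy, rfl⟩ := Finset.mem_image.1 h'
      rwa [dual_dual]

theorem mem_kept {k : ℕ} {a : Idx (2 * n)} :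
    a ∈ kept I (k + 1) ↔ a ∈ col I k ∧ (a : ℕ) ≠ k + 1 := by
  simp [kept]

theorem kept_subset_col (hI : I ∈ admissible n) {k : ℕ} (hk : k < n) :
    kept I (k + 1) ⊆ col I (k + 1) := fun _ ha =>
  (mem_col_succ hI hk (mem_kept.1 ha).1).resolve_right (mem_kept.1 ha).2

theorem initiating_eq_sdiff (k : ℕ) :
    initiating I (k + 1) = col I (k + 1) \ kept I (k + 1) := by
  ext a
  simp only [initiating, Finset.mem_filter, Finset.mem_sdiff, mem_kept, Nat.add_sub_cancel]
  tauto

/-- The contribution of the column `k` to the dimension, summed over the initiating disks. -/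
def diskSum (I : Coll n (2 * n)) (k : ℕ) : ℤ :=
  ∑ l ∈ initiating I k, (white I k l -
    ∑ l' ∈ (col I k).filter (fun l' : Idx (2 * n) => Lt k l' l ∨ l' ∉ initiating I k), s l l' k)

theorem below_insert {N k : ℕ} {j a : Idx N} {A : Finset (Idx N)} (ha : a ∉ A) :
    below k j (insert a A) = below k j A - if Lt k a j then 1 else 0 := by
  unfold below
  split_ifs with h
  · have : Finset.univ.filter (fun x : Idx N => Lt k x j ∧ x ∉ A) =
        insert a (Finset.univ.filter fun x : Idx N => Lt k x j ∧ x ∉ insert a A) := by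
      ext x
      simp only [Finset.mem_filter, Finset.mem_univ, true_and, Finset.mem_insert, not_or]
      by_cases hx : x = a
      · subst hx; simp [h, ha]
      · simp [hx]
    rw [this, Finset.card_insert_of_notMem (by simp)]
    push_cast; ring
  · rw [sub_zero]
    congr 2
    ext x
    simp only [Finset.mem_filter, Finset.mem_univ, true_and, Finset.mem_insert, not_or]
    by_cases hx : x = a
    · subst hx; simp [h]
    · simp [hx]

/-- The labels in `I_{k+1}` outside the kept ones are exactly the initiating labels: one if `k+1 ∉
I_k`, two otherwise. The two formulas differ only in whether white labels are counted relative to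
the kept set or to `I_{k+1}`. -/
theorem increment_eq_diskSum (hI : I ∈ admissible n) {k : ℕ} (hk : k < n) :
    increment I (k + 1) = diskSum I (k + 1) := by
  have hsub := kept_subset_col hI hk
  have hcard := Finset.card_sdiff_add_card_eq_card hsub
  rw [card_col hI hk] at hcard
  by_cases h : ∀ x ∈ col I k, (x : ℕ) ≠ k + 1
  · have hkept : kept I (k + 1) = col I k := by
      ext x; rw [mem_kept]; exact ⟨fun hx => hx.1, fun hx => ⟨hx, h x hx⟩⟩
    rw [hkept, card_col hI hk.le] at hcard
    have h1 : (col I (k + 1) \ col I k).card = 1 := by omega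
    obtain ⟨j, hj⟩ := Finset.card_eq_one.1 h1
    have hjmem : j ∉ col I k :=
      (Finset.mem_sdiff.1 (hj ▸ Finset.mem_singleton_self j)).2
    have hcol : col I (k + 1) = insert j (col I k) := by
      conv_lhs => rw [← Finset.sdiff_union_of_subset (hkept ▸ hsub : col I k ⊆ col I (k + 1)), hj, Finset.singleton_union]
    unfold increment diskSum
    rw [Nat.add_sub_cancel, if_pos h, initiating_eq_sdiff, hkept, hj, Finset.sum_singleton,
      Finset.sum_singleton, white, hcol, below_insert hjmem, if_neg Lt.irrefl, sub_zero]
    congr 2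
    ext x
    simp only [Finset.mem_filter, Finset.mem_insert, Finset.mem_singleton]
    constructor
    · intro hx
      exact ⟨Or.inr hx, Or.inr fun hxj => hjmem (hxj ▸ hx)⟩
    · rintro ⟨rfl | hx, h' | h'⟩
      · exact absurd h' Lt.irrefl
      · exact absurd rfl h'
      · exact hx
      · exact hx
  · have h' := h
    push Not at h'
    obtain ⟨x, hx, hxk⟩ := h'
    have hins : col I k = insert x (kept I (k + 1)) := by
      ext y
      rw [Finset.mem_insert, mem_kept]
      constructor
      · intro hy
        by_cases hyk : (y : ℕ) = k + 1
        · exact Or.inl (Subtype.ext (hyk.trans hxk.symm))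
        · exact Or.inr ⟨hy, hyk⟩
      · rintro (rfl | hy)
        · exact hx
        · exact hy.1
    have hck : (col I k).card = (kept I (k + 1)).card + 1 := by
      conv_lhs => rw [hins]
      exact Finset.card_insert_of_notMem fun hx' => (mem_kept.1 hx').2 hxk
    rw [card_col hI hk.le] at hck
    have h2 : (col I (k + 1) \ kept I (k + 1)).card = 2 := by omega
    obtain ⟨j₁, j₂, hlt, hj⟩ : ∃ j₁ j₂ : Idx (2 * n), Lt (k + 1) j₂ j₁ ∧
        col I (k + 1) \ kept I (k + 1) = {j₁, j₂} := by
      obtain ⟨a, b, hab, hj⟩ := Finset.card_eq_two.1 h2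
      rcases Lt.total (k := k + 1) (fun h => hab (Subtype.ext h)) with h | h
      · exact ⟨b, a, h, hj.trans (Finset.pair_comm a b)⟩
      · exact ⟨a, b, h, hj⟩
    have hne : j₁ ≠ j₂ := fun h => Lt.irrefl (h ▸ hlt)
    have hj₁ : j₁ ∉ kept I (k + 1) :=
      (Finset.mem_sdiff.1 (hj ▸ Finset.mem_insert_self j₁ {j₂})).2
    have hj₂ : j₂ ∉ kept I (k + 1) := (Finset.mem_sdiff.1
      (hj ▸ Finset.mem_insert_of_mem (Finset.mem_singleton_self j₂) : j₂ ∈ _ \ _)).2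
    have hcol : col I (k + 1) = insert j₁ (insert j₂ (kept I (k + 1))) := by
      conv_lhs => rw [← Finset.sdiff_union_of_subset hsub, hj]
      rw [Finset.insert_union, Finset.singleton_union]
    have hpair : (({j₁, j₂} ×ˢ {j₁, j₂} : Finset (Idx (2 * n) × Idx (2 * n))).filter
        fun p => Lt (k + 1) p.2 p.1) = {(j₁, j₂)} := by
      ext ⟨a, b⟩
      simp only [Finset.mem_filter, Finset.mem_product, Finset.mem_insert, Finset.mem_singleton,
        Prod.mk.injEq]
      constructor
      · rintro ⟨⟨rfl | rfl, rfl | rfl⟩, h⟩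
        · exact absurd h Lt.irrefl
        · exact ⟨rfl, rfl⟩
        · exact absurd h hlt.asymm
        · exact absurd h Lt.irrefl
      · rintro ⟨rfl, rfl⟩
        exact ⟨⟨Or.inl rfl, Or.inr rfl⟩, hlt⟩
    have hf₁ : ((col I (k + 1)).filter fun l' : Idx (2 * n) =>
        Lt (k + 1) l' j₁ ∨ l' ∉ ({j₁, j₂} : Finset (Idx (2 * n)))) =
        insert j₂ (kept I (k + 1)) := by
      ext y
      rw [hcol]
      simp only [Finset.mem_filter, Finset.mem_insert, Finset.mem_singleton, not_or]
      constructor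
      · rintro ⟨rfl | hy, h' | h'⟩
        · exact absurd h' Lt.irrefl
        · exact absurd rfl h'.1
        · exact hy
        · exact hy
      · rintro (rfl | hy)
        · exact ⟨Or.inr (Or.inl rfl), Or.inl hlt⟩
        · exact ⟨Or.inr (Or.inr hy), Or.inr ⟨fun h => hj₁ (h ▸ hy), fun h => hj₂ (h ▸ hy)⟩⟩
    have hf₂ : ((col I (k + 1)).filter fun l' : Idx (2 * n) =>
        Lt (k + 1) l' j₂ ∨ l' ∉ ({j₁, j₂} : Finset (Idx (2 * n)))) = kept I (k + 1) := by
      ext y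
      rw [hcol]
      simp only [Finset.mem_filter, Finset.mem_insert, Finset.mem_singleton, not_or]
      constructor
      · rintro ⟨rfl | rfl | hy, h' | h'⟩
        · exact absurd h' hlt.asymm
        · exact absurd rfl h'.1
        · exact absurd h' Lt.irrefl
        · exact absurd rfl h'.2
        · exact hy
        · exact hy
      · intro hy
        exact ⟨Or.inr (Or.inr hy), Or.inr ⟨fun h => hj₁ (h ▸ hy), fun h => hj₂ (h ▸ hy)⟩⟩
    have hj₁' : j₁ ∉ insert j₂ (kept I (k + 1)) := by
      rw [Finset.mem_insert, not_or]
      exact ⟨hne, hj₁⟩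
    unfold increment diskSum
    -- The `-1` of the algorithm comes from `j₂`: it lies below `j₁` and outside the kept set, but
    -- it is not white in column `k+1`.
    rw [Nat.add_sub_cancel, if_neg h, initiating_eq_sdiff, hj, hpair, Finset.sum_singleton,
      Finset.sum_pair hne, hf₁, hf₂, Finset.sum_insert hj₂, white, white, hcol,
      below_insert hj₁', below_insert hj₁', below_insert hj₂, below_insert hj₂,
      if_neg Lt.irrefl, if_pos hlt, if_neg hlt.asymm, if_neg Lt.irrefl, Finset.sum_add_distrib]
    ring

/-- The number of pairs of labels in `A` exchanged by a symplectic relation at step `k`. -/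
def pairCount (A : Finset (Idx (2 * n))) (k : ℕ) : ℤ :=
  ∑ l ∈ A, ∑ l' ∈ A.filter (fun l' : Idx (2 * n) => Lt k l' l), s l l' k

/-- Pairs in `I_{k+1}` are split into kept, initiating and mixed ones. The right-hand side always
puts the initiating label of a mixed pair first, while `pairCount` puts the larger one first;
symmetry of `s` removes the difference. -/
theorem pairCount_col_succ (hI : I ∈ admissible n) {k : ℕ} (hk : k < n) :
    pairCount (col I (k + 1)) (k + 1) = pairCount (kept I (k + 1)) (k + 1) +
      ∑ l ∈ initiating I (k + 1), ∑ l' ∈ (col I (k + 1)).filter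
        (fun l' : Idx (2 * n) => Lt (k + 1) l' l ∨ l' ∉ initiating I (k + 1)), s l l' (k + 1) := by
  have hsub := kept_subset_col hI hk
  set K := kept I (k + 1)
  set D := initiating I (k + 1) with hD
  have hDK : Disjoint D K := by
    rw [hD, initiating_eq_sdiff]; exact Finset.sdiff_disjoint
  have hcol : col I (k + 1) = D ∪ K := by
    rw [hD, initiating_eq_sdiff, Finset.sdiff_union_of_subset hsub]
  have hmem : ∀ l' ∈ K, l' ∉ D := fun l' h h' => Finset.disjoint_left.1 hDK h' h
  have h1 : ∀ l ∈ D, ∑ l' ∈ (D ∪ K).filter (fun l' : Idx (2 * n) => Lt (k + 1) l' l ∨ l' ∉ D),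
      s l l' (k + 1) = ∑ l' ∈ D.filter (fun l' : Idx (2 * n) => Lt (k + 1) l' l), s l l' (k + 1) +
        ∑ l' ∈ K, s l l' (k + 1) := by
    intro l hl
    rw [Finset.filter_union, Finset.sum_union (Finset.disjoint_filter_filter hDK)]
    congr 1
    · exact Finset.sum_congr (Finset.filter_congr fun x hx => by simp [hx]) fun _ _ => rfl
    · exact Finset.sum_congr (Finset.filter_true_of_mem fun x hx => Or.inr (hmem x hx))
        fun _ _ => rfl
  have h2 : ∀ l ∈ D, ∑ l' ∈ K, s l l' (k + 1) =
      ∑ l' ∈ K.filter (fun l' : Idx (2 * n) => Lt (k + 1) l' l), s l l' (k + 1) +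
      ∑ l' ∈ K, if Lt (k + 1) l l' then s l' l (k + 1) else 0 := by
    intro l hl
    rw [Finset.sum_filter, ← Finset.sum_add_distrib]
    refine Finset.sum_congr rfl fun l' hl' => ?_
    have hne : (l : ℕ) ≠ l' := fun h => hmem l' hl' (Subtype.ext h ▸ hl)
    rcases Lt.total (k := k + 1) hne with h | h
    · rw [if_pos h, if_neg h.asymm, zero_add, s_comm hk]
    · rw [if_pos h, if_neg h.asymm, add_zero]
  unfold pairCount
  rw [hcol, Finset.sum_congr rfl h1, Finset.sum_union hDK]
  have h3 : ∀ l : Idx (2 * n), ∑ l' ∈ (D ∪ K).filter (fun l' : Idx (2 * n) => Lt (k + 1) l' l), s l l' (k + 1) =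
      ∑ l' ∈ D.filter (fun l' : Idx (2 * n) => Lt (k + 1) l' l), s l l' (k + 1) +
      ∑ l' ∈ K.filter (fun l' : Idx (2 * n) => Lt (k + 1) l' l), s l l' (k + 1) := fun l => by
    rw [Finset.filter_union, Finset.sum_union (Finset.disjoint_filter_filter hDK)]
  simp only [h3, Finset.sum_add_distrib]
  rw [Finset.sum_congr rfl h2, Finset.sum_add_distrib]
  have h4 : ∑ l ∈ K, ∑ l' ∈ D.filter (fun l' : Idx (2 * n) => Lt (k + 1) l' l), s l l' (k + 1) =
      ∑ l ∈ D, ∑ l' ∈ K, if Lt (k + 1) l l' then s l' l (k + 1) else 0 := by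
    rw [Finset.sum_comm]
    exact Finset.sum_congr rfl fun l _ => Finset.sum_filter _ _
  rw [h4]
  ring

/-- Dropping the label `k+1` costs nothing, since it is minimal for `<_k` and so every `s` involving
it vanishes; on the other labels neither the order nor `s` changes. -/
theorem pairCount_kept {k : ℕ} (hk : k < n) :
    pairCount (kept I (k + 1)) (k + 1) = pairCount (col I k) k := by
  unfold pairCount
  have hK : kept I (k + 1) = (col I k).filter fun x : Idx (2 * n) => (x : ℕ) ≠ k + 1 := rfl
  rw [hK, Finset.sum_filter]
  refine Finset.sum_congr rfl fun l hl => ?_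
  split_ifs with h
  · rw [Finset.filter_filter, Finset.sum_filter, Finset.sum_filter]
    refine Finset.sum_congr rfl fun l' hl' => ?_
    by_cases h' : (l' : ℕ) = k + 1
    · rw [s_comm hk.le l l', s_eq_zero _ h', if_neg (by tauto)]
      simp
    · simp only [h', ne_eq, not_false_iff, true_and, lt_succ_iff h' h, s_succ hk h h']
  · push Not at h
    exact (Finset.sum_eq_zero fun l' _ => s_eq_zero _ h).symm

/-- The number of free parameters of `V_k` inside `V_{k+1} ∩ {x_{k+1} = 0} ⊕ ℂ e_{k+1}` in the
row `i`. -/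
def relBelow (I : Coll n (2 * n)) (k : ℕ) (i : Idx (2 * n)) : ℕ :=
  (Finset.univ.filter fun b : Idx (2 * n) =>
    b ∉ col I k ∧ Lt k b i ∧ (b ∈ col I (k + 1) ∨ (b : ℕ) = k + 1)).card

/-- The white positions under `i` in column `k` are split by membership in `I_{k+1} ∪ {k+1}`. Those
outside are the white positions under `i` in column `k+1`, where `k+1`, now maximal, lies under
nothing. -/
theorem relBelow_add_below (hI : I ∈ admissible n) {k : ℕ} (hk : k < n) {i : Idx (2 * n)}
    (hi : (i : ℕ) ≠ k + 1) :
    relBelow I k i + below (k + 1) i (col I (k + 1)) = below k i (col I k) := by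
  unfold relBelow below
  rw [← Nat.cast_add, Nat.cast_inj, ← Finset.card_union_of_disjoint]
  · congr 1
    ext b
    simp only [Finset.mem_union, Finset.mem_filter, Finset.mem_univ, true_and]
    have := mem_col_succ hI hk (a := b)
    by_cases hb : (b : ℕ) = k + 1
    · have : ¬ Lt (k + 1) b i := by rw [hb]; exact not_succ_lt
      tauto
    · rw [lt_succ_iff hb hi]
      tauto
  · rw [Finset.disjoint_filter]
    rintro b - ⟨h1, h2, h3⟩ ⟨h4, h5⟩
    rcases h3 with h3 | h3
    · exact h5 h3
    · rw [h3] at h4; exact not_succ_lt h4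

theorem below_eq_zero {k : ℕ} {i : Idx (2 * n)} (hi : (i : ℕ) = k + 1)
    (A : Finset (Idx (2 * n))) : below k i A = 0 := by
  unfold below
  rw [Finset.filter_false_of_mem]
  · simp
  · intro b _ h
    rw [hi] at h
    exact not_lt_succ_self h.1

theorem relBelow_eq_zero {k : ℕ} {i : Idx (2 * n)} (hi : (i : ℕ) = k + 1) :
    relBelow I k i = 0 := by
  unfold relBelow
  rw [Finset.filter_false_of_mem]
  · simp
  · intro b _ h
    rw [hi] at h
    exact not_lt_succ_self h.2.1

theorem sum_below_succ (hI : I ∈ admissible n) {k : ℕ} (hk : k < n) :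
    ∑ i ∈ col I (k + 1), below (k + 1) i (col I (k + 1)) + ∑ i ∈ col I k, (relBelow I k i : ℤ) =
      ∑ i ∈ col I k, below k i (col I k) +
        ∑ l ∈ initiating I (k + 1), white I (k + 1) l := by
  have hK : kept I (k + 1) = (col I k).filter fun x : Idx (2 * n) => (x : ℕ) ≠ k + 1 := rfl
  have h1 : ∑ i ∈ col I k, below k i (col I k) = ∑ i ∈ kept I (k + 1), below k i (col I k) := by
    rw [hK, Finset.sum_filter]
    refine Finset.sum_congr rfl fun i _ => ?_
    split_ifs with h
    · rfl
    · exact below_eq_zero (not_not.1 h) _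
  have h2 : ∑ i ∈ col I k, (relBelow I k i : ℤ) =
      ∑ i ∈ kept I (k + 1), (relBelow I k i : ℤ) := by
    rw [hK, Finset.sum_filter]
    refine Finset.sum_congr rfl fun i _ => ?_
    split_ifs with h
    · rfl
    · rw [relBelow_eq_zero (not_not.1 h), Nat.cast_zero]
  rw [h1, h2, ← Finset.sum_sdiff (kept_subset_col hI hk), initiating_eq_sdiff, add_assoc,
    ← Finset.sum_add_distrib, add_comm]
  congr 1
  refine Finset.sum_congr rfl fun i hi => ?_
  rw [← relBelow_add_below hI hk (mem_kept.1 hi).2, add_comm]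

/-- The invariant linking the two directions: entries allowed in column `k`, minus symplectic
relations, plus the relative parameters of all earlier columns. Its increments are the `diskSum`s by
`sum_below_succ`, `pairCount_col_succ` and `pairCount_kept`. -/
theorem d_eq (hI : I ∈ admissible n) {k : ℕ} (hk : k ≤ n) :
    d I k = ∑ i ∈ col I k, below k i (col I k) - pairCount (col I k) k +
      ∑ j ∈ Finset.range k, ∑ i ∈ col I j, (relBelow I j i : ℤ) := by
  induction k with
  | zero => simp [d, col_zero, pairCount]
  | succ k ih =>
    have h1 := sum_below_succ hI hk
    have h2 := pairCount_col_succ hI hk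
    rw [pairCount_kept hk] at h2
    rw [d, ih (by omega), increment_eq_diskSum hI hk, diskSum, Finset.sum_sub_distrib,
      Finset.sum_range_succ]
    linarith

/-- The number of free parameters of the Lagrangian subspace `V_n` in the row `i`. -/
def lagBelow (I : Coll n (2 * n)) (i : Idx (2 * n)) : ℕ :=
  (Finset.univ.filter fun b : Idx (2 * n) =>
    b ∉ col I n ∧ Lt n b i ∧ ¬ Lt n (dual b) i).card

theorem sum_lagBelow (hI : I ∈ admissible n) :
    ∑ i ∈ col I n, (lagBelow I i : ℤ) =
      ∑ i ∈ col I n, below n i (col I n) - pairCount (col I n) n := by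
  unfold pairCount
  rw [← Finset.sum_sub_distrib]
  refine Finset.sum_congr rfl fun i _ => ?_
  have h : ∑ l' ∈ (col I n).filter (fun l' : Idx (2 * n) => Lt n l' i), s i l' n =
      ((Finset.univ.filter fun b : Idx (2 * n) =>
        (Lt n b i ∧ b ∉ col I n) ∧ Lt n (dual b) i).card : ℤ) := by
    simp only [s_last]
    rw [← Finset.sum_filter, Finset.filter_filter, Finset.sum_const, nsmul_one, Nat.cast_inj]
    -- At `k = n` the window is everything, so `s i l' n = 1` says `dual l' <_n i`; duality turns
    -- these pivots `l'` into the non-free positions of row `i`.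
    refine Finset.card_nbij' dual dual ?_ ?_ (fun _ _ => dual_dual _) (fun _ _ => dual_dual _)
    · intro x hx
      simp only [Finset.coe_filter, Finset.mem_univ, true_and] at hx ⊢
      refine ⟨⟨hx.2.2, ?_⟩, by rw [dual_dual]; exact hx.2.1⟩
      rw [← dual_mem_col_iff hI, dual_dual]
      exact hx.1
    · intro x hx
      simp only [Finset.coe_filter, Finset.mem_univ, true_and] at hx ⊢
      refine ⟨(dual_mem_col_iff hI x).2 hx.1.2, hx.2, ?_⟩
      rw [← coe_dual, dual_dual]
      exact hx.1.1
  rw [h, eq_sub_iff_add_eq]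
  unfold lagBelow below
  rw [← Nat.cast_add, Nat.cast_inj, add_comm, ← Finset.filter_filter,
    ← Finset.card_filter_add_card_filter_not (s := Finset.univ.filter
      fun b : Idx (2 * n) => Lt n b i ∧ b ∉ col I n) (fun b => Lt n (dual b) i)]
  congr 2
  ext b
  simp only [Finset.mem_filter, Finset.mem_univ, true_and]
  tauto

theorem d_last (hI : I ∈ admissible n) :
    d I n = ((∑ i ∈ col I n, lagBelow I i +
      ∑ k ∈ Finset.range n, ∑ i ∈ col I k, relBelow I k i : ℕ) : ℤ) := by
  rw [d_eq hI le_rfl, ← sum_lagBelow hI]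
  push_cast
  rfl

end Admissible

/-! ### Reduced row echelon matrices -/

section Reduced

variable {N : ℕ}

/-- The rows of `R` indexed by `A` restrict to the identity matrix on the columns `A`. -/
def IsReduced (A : Finset (Idx N)) (R : Idx N → Idx N → ℂ) : Prop :=
  ∀ i ∈ A, ∀ b ∈ A, R i b = if b = i then 1 else 0

/-- The span of the rows of `R` indexed by `A`. -/
def rowSpan (A : Finset (Idx N)) (R : Idx N → Idx N → ℂ) : Submodule ℂ (E N) :=
  Submodule.span ℂ (Set.range fun i : {i // i ∈ A} => (R i : E N))

variable {A : Finset (Idx N)} {R : Idx N → Idx N → ℂ}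

theorem row_mem_rowSpan {i : Idx N} (hi : i ∈ A) : (R i : E N) ∈ rowSpan A R :=
  Submodule.subset_span ⟨⟨i, hi⟩, rfl⟩

theorem IsReduced.linearIndependent (h : IsReduced A R) :
    LinearIndependent ℂ (fun i : {i // i ∈ A} => (R i : E N)) := by
  rw [Fintype.linearIndependent_iff]
  intro g hg j
  have := congrFun hg j.1
  rw [Finset.sum_apply, Finset.sum_eq_single j] at this
  · simpa [h j.1 j.2 j.1 j.2] using this
  · intro i _ hij
    simp [h i.1 i.2 j.1 j.2, show j.1 ≠ i.1 from fun h => hij (Subtype.ext h.symm)]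
  · simp

/-- The coefficients of a vector of the span are its own coordinates at the pivots. This turns
inclusions of subspaces into explicit equations. -/
theorem IsReduced.mem_rowSpan_iff (h : IsReduced A R) {v : E N} :
    v ∈ rowSpan A R ↔ ∀ b, v b = ∑ j ∈ A, v j * R j b := by
  constructor
  · intro hv
    induction hv using Submodule.span_induction with
    | mem x hx =>
      obtain ⟨i, rfl⟩ := hx
      intro b
      rw [Finset.sum_eq_single i.1]
      · simp [h i.1 i.2 i.1 i.2]
      · intro j hj hji
        simp [h i.1 i.2 j hj, hji]
      · exact fun hi => absurd i.2 hi
    | zero => simp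
    | add x y _ _ hx hy =>
      intro b
      simp only [Pi.add_apply, add_mul, Finset.sum_add_distrib]
      rw [← hx, ← hy]
    | smul c x _ hx =>
      intro b
      simp only [Pi.smul_apply, smul_eq_mul, mul_assoc, ← Finset.mul_sum]
      rw [← hx]
  · intro hv
    have : v = ∑ j ∈ A, v j • (R j : E N) := by
      funext b
      rw [hv b, Finset.sum_apply]
      rfl
    rw [this]
    exact Submodule.sum_mem _ fun j hj => Submodule.smul_mem _ _ (row_mem_rowSpan hj)

/-- The entries of `R` vanish above the leading ones with respect to the order `<_k`. -/
def IsLower (k : ℕ) (A : Finset (Idx N)) (R : Idx N → Idx N → ℂ) : Prop :=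
  ∀ i ∈ A, ∀ b ∉ A, ¬ Lt k b i → R i b = 0

theorem e_add_sum_apply (k : ℕ) (A : Finset (Idx N)) (x : Idx N → ℂ) (i c : Idx N) :
    (e i + ∑ b ∈ Finset.univ.filter (fun b : Idx N => Lt k b i ∧ b ∉ A), x b • e b : E N) c =
      (if c = i then 1 else 0) + if Lt k c i ∧ c ∉ A then x c else 0 := by
  rw [Pi.add_apply, Finset.sum_apply, Finset.sum_filter, Finset.sum_eq_single c]
  · simp [e, Pi.single_apply]
  · intro b _ hb
    simp [e, hb.symm]
  · simp

theorem exists_basis_iff {k : ℕ} {V : Submodule ℂ (E N)} :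
    (∃ (x : Idx N → Idx N → ℂ) (B : Module.Basis {i // i ∈ A} ℂ V), ∀ i : {i // i ∈ A},
      (B i : E N) = e i.1 + ∑ b ∈ Finset.univ.filter (fun b : Idx N => Lt k b i.1 ∧ b ∉ A),
        x i.1 b • e b) ↔
    ∃ R : Idx N → Idx N → ℂ, IsReduced A R ∧ IsLower k A R ∧ V = rowSpan A R := by
  constructor
  · rintro ⟨x, B, hB⟩
    let R : Idx N → Idx N → ℂ := fun i =>
      e i + ∑ b ∈ Finset.univ.filter (fun b : Idx N => Lt k b i ∧ b ∉ A), x i b • e b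
    refine ⟨R, ?_, ?_, ?_⟩
    · intro i _ b hb
      refine (e_add_sum_apply k A (x i) i b).trans ?_
      simp [hb]
    · intro i hi b hb h
      refine (e_add_sum_apply k A (x i) i b).trans ?_
      simp [h, show b ≠ i from fun h => hb (h ▸ hi)]
    · have h1 := congrArg (Submodule.map V.subtype) B.span_eq
      rw [Submodule.map_top, Submodule.range_subtype, Submodule.map_span, ← Set.range_comp] at h1
      rw [← h1]
      unfold rowSpan
      congr 2
      funext i
      exact hB i
  · rintro ⟨R, hR, hL, rfl⟩
    refine ⟨R, Module.Basis.span hR.linearIndependent, fun i => ?_⟩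
    refine (congrArg Subtype.val (Module.Basis.span_apply hR.linearIndependent i)).trans ?_
    funext c
    rw [e_add_sum_apply]
    by_cases hc : c ∈ A
    · simp [hc, hR i.1 i.2 c hc]
    · rw [if_neg fun h : c = i.1 => hc (h ▸ i.2), zero_add]
      split_ifs with h
      · rfl
      · exact hL i.1 i.2 c hc fun h' => h ⟨h', hc⟩

end Reduced

/-! ### The equations of a cell in the affine chart of reduced matrices -/

section Equations

variable {n : ℕ}

/-- The sign of the pairing of `e_i` with its dual basis vector. -/
def eps (i : Idx (2 * n)) : ℂ := if (i : ℕ) ≤ n then 1 else -1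

theorem eps_mul_self (i : Idx (2 * n)) : eps i * eps i = 1 := by
  unfold eps; split_ifs <;> norm_num

theorem eps_dual (i : Idx (2 * n)) : eps (dual i) = -eps i := by
  have := i.one_le; have := i.le
  unfold eps
  rw [coe_dual]
  split_ifs <;> first | omega | norm_num

theorem form_eq_sum (u v : E (2 * n)) : form u v = ∑ k, eps k * u k * v (dual k) := by
  unfold form dotProduct Matrix.mulVec dotProduct
  refine Finset.sum_congr rfl fun k _ => ?_
  rw [Finset.sum_eq_single (dual k)]
  · have h : gram n k (dual k) = eps k := if_pos (add_eq_iff_eq_dual.2 rfl)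
    beta_reduce
    rw [h]
    ring
  · intro l _ hl
    have h : gram n k l = 0 := if_neg fun h => hl (add_eq_iff_eq_dual.1 h)
    beta_reduce
    rw [h, zero_mul]
  · simp

variable {I : Coll n (2 * n)}

/-- Exactly one of `k` and `dual k` is a pivot, so reducedness kills every term of the form except
`k = i` and `k = dual i'`. -/
theorem form_rows (hI : I ∈ admissible n) {R : Idx (2 * n) → Idx (2 * n) → ℂ}
    (hR : IsReduced (col I n) R) {i i' : Idx (2 * n)} (hi : i ∈ col I n) (hi' : i' ∈ col I n) :
    form (R i) (R i') = eps i * R i' (dual i) - eps i' * R i (dual i') := by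
  have hne : i ≠ dual i' := fun h => (dual_mem_col_iff hI i').1 (h ▸ hi) hi'
  rw [form_eq_sum, Finset.sum_eq_add i (dual i') hne]
  · rw [dual_dual, hR i hi i hi, hR i' hi' i' hi', if_pos rfl, if_pos rfl, eps_dual]
    ring
  · rintro k - ⟨hk, hk'⟩
    by_cases hkc : k ∈ col I n
    · rw [hR i hi k hkc, if_neg hk]
      ring
    · rw [hR i' hi' (dual k) ((dual_mem_col_iff hI k).2 hkc), if_neg, mul_zero]
      rintro rfl
      exact hk' (dual_dual k).symm
  · simp
  · simp

theorem form_eq_zero_of_rows {A : Finset (Idx (2 * n))} {R : Idx (2 * n) → Idx (2 * n) → ℂ}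
    (h : ∀ i ∈ A, ∀ i' ∈ A, form (R i) (R i') = 0) {u v : E (2 * n)} (hu : u ∈ rowSpan A R)
    (hv : v ∈ rowSpan A R) : form u v = 0 := by
  have hadd : ∀ u u' v : E (2 * n), form (u + u') v = form u v + form u' v := fun u u' v => by
    simp [form, add_dotProduct]
  have hsmul : ∀ (c : ℂ) (u v : E (2 * n)), form (c • u) v = c * form u v := fun c u v => by
    simp [form, smul_dotProduct]
  have hadd' : ∀ u v v' : E (2 * n), form u (v + v') = form u v + form u v' := fun u v v' => by
    simp [form, Matrix.mulVec_add, dotProduct_add]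
  have hsmul' : ∀ (c : ℂ) (u v : E (2 * n)), form u (c • v) = c * form u v := fun c u v => by
    simp [form, Matrix.mulVec_smul, dotProduct_smul]
  have hzero : ∀ v : E (2 * n), form 0 v = 0 := fun v => by simp [form]
  have hzero' : ∀ v : E (2 * n), form v 0 = 0 := fun v => by simp [form]
  induction hu using Submodule.span_induction with
  | mem x hx =>
    obtain ⟨i, rfl⟩ := hx
    induction hv using Submodule.span_induction with
    | mem y hy =>
      obtain ⟨i', rfl⟩ := hy
      exact h _ i.2 _ i'.2
    | zero => exact hzero' _
    | add y z _ _ hy hz => rw [hadd', hy, hz, add_zero]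
    | smul c y _ hy => rw [hsmul', hy, mul_zero]
  | zero => exact hzero _
  | add x y _ _ hx hy => rw [hadd, hx, hy, add_zero]
  | smul c x _ hx => rw [hsmul, hx, mul_zero]

/-- The equations satisfied by the reduced matrices of a point of the cell. -/
structure IsSolution (I : Coll n (2 * n)) (R : ℕ → Idx (2 * n) → Idx (2 * n) → ℂ) : Prop where
  reduced : ∀ k ≤ n, IsReduced (col I k) (R k)
  lower : ∀ k ≤ n, IsLower k (col I k) (R k)
  step : ∀ k < n, ∀ i ∈ col I k, ∀ b ∉ col I (k + 1), (b : ℕ) ≠ k + 1 →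
    R k i b = ∑ j ∈ (col I (k + 1)).filter (fun j : Idx (2 * n) => (j : ℕ) ≠ k + 1),
      R k i j * R (k + 1) j b
  lagrangian : ∀ i ∈ col I n, ∀ i' ∈ col I n,
    eps i * R n i' (dual i) = eps i' * R n i (dual i')

theorem pr_apply {N k : ℕ} (v : E N) (i : Idx N) :
    pr k v i = if (i : ℕ) = k then 0 else v i := rfl

theorem map_pr_le_iff {k : ℕ} {R R' : Idx (2 * n) → Idx (2 * n) → ℂ}
    (hR' : IsReduced (col I (k + 1)) R') (hL' : IsLower (k + 1) (col I (k + 1)) R') :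
    (rowSpan (col I k) R).map (pr (k + 1)) ≤ rowSpan (col I (k + 1)) R' ↔
      ∀ i ∈ col I k, ∀ b ∉ col I (k + 1), (b : ℕ) ≠ k + 1 →
        R i b = ∑ j ∈ (col I (k + 1)).filter (fun j : Idx (2 * n) => (j : ℕ) ≠ k + 1),
          R i j * R' j b := by
  have hsum : ∀ i b, ∑ j ∈ col I (k + 1), pr (k + 1) (R i) j * R' j b =
      ∑ j ∈ (col I (k + 1)).filter (fun j : Idx (2 * n) => (j : ℕ) ≠ k + 1),
          R i j * R' j b := by
    intro i b
    rw [Finset.sum_filter]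
    refine Finset.sum_congr rfl fun j _ => ?_
    by_cases hj : (j : ℕ) = k + 1 <;> simp [pr_apply, hj]
  rw [rowSpan, Submodule.map_span, Submodule.span_le]
  constructor
  · intro h i hi b hb hbk
    have hmem : pr (k + 1) (R i) ∈ rowSpan (col I (k + 1)) R' := h ⟨R i, ⟨⟨i, hi⟩, rfl⟩, rfl⟩
    have := hR'.mem_rowSpan_iff.1 hmem b
    rwa [hsum, pr_apply, if_neg hbk] at this
  · rintro h _ ⟨_, ⟨i, rfl⟩, rfl⟩
    refine hR'.mem_rowSpan_iff.2 fun b => ?_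
    by_cases hb : b ∈ col I (k + 1)
    · rw [Finset.sum_eq_single b]
      · rw [hR' b hb b hb, if_pos rfl, mul_one]
      · intro j hj hjb
        rw [hR' j hj b hb, if_neg hjb.symm, mul_zero]
      · exact fun h => absurd hb h
    -- The coordinate `k+1` imposes no equation: the projection kills it on the left, and since
    -- `k+1` is maximal for `<_{k+1}`, a non-pivot column `k+1` of `R'` is zero.
    · by_cases hbk : (b : ℕ) = k + 1
      · rw [pr_apply, if_pos hbk, Finset.sum_eq_zero]
        intro j hj
        rw [hL' j hj b hb (by rw [hbk]; exact not_succ_lt), mul_zero]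
      · rw [hsum, pr_apply, if_neg hbk]
        exact h i.1 i.2 b hb hbk

theorem mem_cell_iff (hI : I ∈ admissible n) {V : GrProd n (2 * n)} :
    V ∈ cell I ↔ ∃ R, IsSolution I R ∧ ∀ k : Idx n, V.sub k = rowSpan (col I k) (R k) := by
  have hIcc : ∀ {k : ℕ}, 1 ≤ k → k ≤ n → k ∈ Finset.Icc 1 n := fun h h' =>
    Finset.mem_Icc.2 ⟨h, h'⟩
  constructor
  · rintro ⟨⟨hflag, hlag⟩, -, hB⟩
    have hex : ∀ k : Idx n, ∃ R : Idx (2 * n) → Idx (2 * n) → ℂ, IsReduced (col I k) R ∧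
        IsLower k (col I k) R ∧ V.sub k = rowSpan (col I k) R := by
      intro k
      rw [col_eq]
      exact exists_basis_iff.1 (hB k)
    choose R hR hL hV using hex
    -- The value `0` outside `1, …, n` is harmless: for `k = 0` there are no rows, and larger `k`
    -- never occur.
    let R' : ℕ → Idx (2 * n) → Idx (2 * n) → ℂ := fun k =>
      if h : k ∈ Finset.Icc 1 n then R ⟨k, h⟩ else 0
    have hR' : ∀ k : Idx n, R' k = R k := fun k => dif_pos k.2
    have hred : ∀ k ≤ n, IsReduced (col I k) (R' k) := by
      intro k hk
      rcases Nat.eq_zero_or_pos k with rfl | h0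
      · intro i hi
        simp [col_zero] at hi
      · exact (hR' ⟨k, hIcc h0 hk⟩) ▸ hR ⟨k, hIcc h0 hk⟩
    have hlow : ∀ k ≤ n, IsLower k (col I k) (R' k) := by
      intro k hk
      rcases Nat.eq_zero_or_pos k with rfl | h0
      · intro i hi
        simp [col_zero] at hi
      · exact (hR' ⟨k, hIcc h0 hk⟩) ▸ hL ⟨k, hIcc h0 hk⟩
    refine ⟨R', ⟨hred, hlow, ?_, ?_⟩, fun k => by rw [hR', hV]⟩
    · intro k hk
      rcases Nat.eq_zero_or_pos k with rfl | h0
      · intro i hi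
        simp [col_zero] at hi
      · refine (map_pr_le_iff (hred (k + 1) hk) (hlow (k + 1) hk)).1 ?_
        have := hflag ⟨k, hIcc h0 hk.le⟩ ⟨k + 1, hIcc (by omega) hk⟩ rfl
        rwa [hV, hV, ← hR', ← hR'] at this
    · intro i hi i' hi'
      have h1 : 1 ≤ n := by have := i.one_le; have := i.le; omega
      have hVn : V.sub ⟨n, hIcc h1 le_rfl⟩ = rowSpan (col I n) (R' n) := by
        rw [hV, ← hR']
      have := hlag ⟨n, hIcc h1 le_rfl⟩ rfl (R' n i) (hVn ▸ row_mem_rowSpan hi) (R' n i')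
        (hVn ▸ row_mem_rowSpan hi')
      rw [form_rows hI (hred n le_rfl) hi hi'] at this
      exact sub_eq_zero.1 this
  · rintro ⟨R, hR, hV⟩
    have hflag : ∀ k k' : Idx n, (k' : ℕ) = k + 1 → (V.sub k).map (pr (k + 1)) ≤ V.sub k' := by
      rintro ⟨k, hk⟩ ⟨k', hk'⟩ (rfl : k' = k + 1)
      rw [hV, hV]
      have hk1 := (Finset.mem_Icc.1 hk').2
      exact (map_pr_le_iff (hR.reduced (k + 1) hk1) (hR.lower (k + 1) hk1)).2 (hR.step k hk1)
    refine ⟨⟨hflag, ?_⟩, hflag, fun k => ?_⟩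
    · rintro ⟨k, hk⟩ (rfl : k = n) u hu v hv
      rw [hV] at hu hv
      refine form_eq_zero_of_rows (fun i hi i' hi' => ?_) hu hv
      rw [form_rows hI (hR.reduced k le_rfl) hi hi']
      exact sub_eq_zero.2 (hR.lagrangian i hi i' hi')
    · refine exists_basis_iff.2 ⟨R k, ?_, ?_, ?_⟩
      · exact col_eq I k ▸ hR.reduced k k.le
      · exact col_eq I k ▸ hR.lower k k.le
      · exact col_eq I k ▸ hV k

end Equations

/-! ### Polynomial parametrization of a cell -/

section Parametrization

variable {n : ℕ} (I : Coll n (2 * n))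

/-- The positions of the free entries of the reduced matrices of a point of the cell. -/
def freeEntries : Finset (ℕ × Idx (2 * n) × Idx (2 * n)) :=
  (Finset.range (n + 1) ×ˢ Finset.univ ×ˢ Finset.univ).filter fun t =>
    t.2.1 ∈ col I t.1 ∧ t.2.2 ∉ col I t.1 ∧ Lt t.1 t.2.2 t.2.1 ∧
      if t.1 = n then ¬ Lt n (dual t.2.2) t.2.1
      else t.2.2 ∈ col I (t.1 + 1) ∨ (t.2.2 : ℕ) = t.1 + 1

theorem mem_freeEntries_last {i b : Idx (2 * n)} : (n, i, b) ∈ freeEntries I ↔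
    i ∈ col I n ∧ b ∉ col I n ∧ Lt n b i ∧ ¬ Lt n (dual b) i := by
  have h : (n, i, b) ∈ Finset.range (n + 1) ×ˢ (Finset.univ ×ˢ Finset.univ) :=
    Finset.mem_product.2 ⟨Finset.mem_range.2 n.lt_succ_self,
      Finset.mem_product.2 ⟨Finset.mem_univ _, Finset.mem_univ _⟩⟩
  rw [freeEntries, Finset.mem_filter, if_pos rfl]
  exact and_iff_right h

theorem mem_freeEntries_of_lt {k : ℕ} (hk : k < n) {i b : Idx (2 * n)} :
    (k, i, b) ∈ freeEntries I ↔ i ∈ col I k ∧ b ∉ col I k ∧ Lt k b i ∧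
      (b ∈ col I (k + 1) ∨ (b : ℕ) = k + 1) := by
  have h : (k, i, b) ∈ Finset.range (n + 1) ×ˢ (Finset.univ ×ˢ Finset.univ) :=
    Finset.mem_product.2 ⟨Finset.mem_range.2 (by omega),
      Finset.mem_product.2 ⟨Finset.mem_univ _, Finset.mem_univ _⟩⟩
  rw [freeEntries, Finset.mem_filter, if_neg hk.ne]
  exact and_iff_right h

theorem card_freeEntries : (freeEntries I).card = ∑ i ∈ col I n, lagBelow I i +
    ∑ k ∈ Finset.range n, ∑ i ∈ col I k, relBelow I k i := by
  have key : ∀ (A : Finset (Idx (2 * n))) (p : Idx (2 * n) → Idx (2 * n) → Prop)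
      [∀ i b, Decidable (p i b)],
      ∑ t : Idx (2 * n) × Idx (2 * n), (if t.1 ∈ A ∧ p t.1 t.2 then 1 else 0) =
        ∑ i ∈ A, (Finset.univ.filter fun b => p i b).card := by
    intro A p _
    rw [Fintype.sum_prod_type, ← Finset.sum_subset (Finset.subset_univ A)]
    · refine Finset.sum_congr rfl fun i hi => ?_
      simp [hi]
    · intro i _ hi
      simp [hi]
  rw [freeEntries, Finset.card_filter, Finset.sum_product, Finset.sum_range_succ, add_comm]
  congr 1
  · simp only [if_true, Finset.univ_product_univ]
    exact key _ fun i b => b ∉ col I n ∧ Lt n b i ∧ ¬ Lt n (dual b) i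
  · refine Finset.sum_congr rfl fun k hk => ?_
    simp only [(Finset.mem_range.1 hk).ne, if_false, Finset.univ_product_univ]
    exact key _ fun i b => b ∉ col I k ∧ Lt k b i ∧ (b ∈ col I (k + 1) ∨ (b : ℕ) = k + 1)

/-- The coordinate functions on the space of free entries, extended by zero. -/
noncomputable def entryVar (k : ℕ) (i b : Idx (2 * n)) :
    MvPolynomial {t // t ∈ freeEntries I} ℂ :=
  if h : (k, i, b) ∈ freeEntries I then MvPolynomial.X ⟨_, h⟩ else 0

/-- The reduced matrix of `V_n` as a polynomial in the free entries. -/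
noncomputable def lastMatrix (i b : Idx (2 * n)) : MvPolynomial {t // t ∈ freeEntries I} ℂ :=
  if b ∈ col I n then (if b = i then 1 else 0)
  else if Lt n b i then
    if Lt n (dual b) i then
      MvPolynomial.C (eps i * eps (dual b)) * entryVar I n (dual b) (dual i)
    else entryVar I n i b
  else 0

/-- The reduced matrix of `V_k` as a polynomial in the free entries, in terms of that
of `V_{k+1}`. -/
noncomputable def stepMatrix (k : ℕ)
    (P : Idx (2 * n) → Idx (2 * n) → MvPolynomial {t // t ∈ freeEntries I} ℂ)
    (i b : Idx (2 * n)) : MvPolynomial {t // t ∈ freeEntries I} ℂ :=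
  if b ∈ col I k then (if b = i then 1 else 0)
  else if b ∈ col I (k + 1) ∨ (b : ℕ) = k + 1 then entryVar I k i b
  else ∑ j ∈ (col I (k + 1)).filter (fun j : Idx (2 * n) => (j : ℕ) ≠ k + 1),
    (if j ∈ col I k then (if j = i then 1 else 0) else entryVar I k i j) * P j b

/-- The reduced matrix of `V_{n-t}` as a polynomial in the free entries. -/
noncomputable def polyMatrixAux :
    ℕ → Idx (2 * n) → Idx (2 * n) → MvPolynomial {t // t ∈ freeEntries I} ℂ
  | 0 => lastMatrix I
  | t + 1 => stepMatrix I (n - (t + 1)) (polyMatrixAux t)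

/-- The reduced matrix of `V_k` as a polynomial in the free entries. -/
noncomputable def polyMatrix (k : ℕ) :
    Idx (2 * n) → Idx (2 * n) → MvPolynomial {t // t ∈ freeEntries I} ℂ :=
  polyMatrixAux I (n - k)

theorem polyMatrix_last : polyMatrix I n = lastMatrix I := by
  rw [polyMatrix, Nat.sub_self, polyMatrixAux]

theorem polyMatrix_of_lt {k : ℕ} (hk : k < n) :
    polyMatrix I k = stepMatrix I k (polyMatrix I (k + 1)) := by
  rw [polyMatrix, polyMatrix, show n - k = n - (k + 1) + 1 by omega, polyMatrixAux,
    show n - (n - (k + 1) + 1) = k by omega]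

variable {I}

/-- `dual` reverses `<_n`. Hence the two entries exchanged by a Lagrangian relation are either both
in triangular position or both forced to be zero. -/
theorem lt_dual_iff {a b : Idx (2 * n)} : Lt n (dual a) b ↔ Lt n (dual b) a := by
  have := a.one_le; have := a.le; have := b.one_le; have := b.le
  unfold Lt
  rw [coe_dual, coe_dual]
  omega

theorem mem_freeEntries_dual (hI : I ∈ admissible n) {i b : Idx (2 * n)} (hi : i ∈ col I n)
    (hb : b ∉ col I n) (h : Lt n b i) (h' : Lt n (dual b) i) :
    (n, dual b, dual i) ∈ freeEntries I := by
  refine (mem_freeEntries_last I).2 ⟨(dual_mem_col_iff hI b).2 hb, ?_, ?_, ?_⟩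
  · rw [dual_mem_col_iff hI]
    exact not_not.2 hi
  · rw [lt_dual_iff, dual_dual]
    exact h
  · rw [dual_dual]
    exact h'.asymm

/-- Every solution is recovered from its free entries. -/
theorem IsSolution.eq_eval (hI : I ∈ admissible n) {R : ℕ → Idx (2 * n) → Idx (2 * n) → ℂ}
    (hR : IsSolution I R) {k : ℕ} (hk : k ≤ n) : ∀ i ∈ col I k, ∀ b, R k i b =
      MvPolynomial.eval (fun t : {t // t ∈ freeEntries I} => R t.1.1 t.1.2.1 t.1.2.2)
        (polyMatrix I k i b) := by
  set y : {t // t ∈ freeEntries I} → ℂ := fun t => R t.1.1 t.1.2.1 t.1.2.2 with hy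
  have hvar : ∀ {k i b}, (k, i, b) ∈ freeEntries I →
      MvPolynomial.eval y (entryVar I k i b) = R k i b := by
    intro k i b h
    rw [entryVar, dif_pos h, MvPolynomial.eval_X]
  have hvar' : ∀ {k i b}, (k, i, b) ∉ freeEntries I →
      MvPolynomial.eval y (entryVar I k i b) = 0 := by
    intro k i b h
    rw [entryVar, dif_neg h, map_zero]
  have hite : ∀ b i : Idx (2 * n), MvPolynomial.eval y (if b = i then 1 else 0) =
      if b = i then 1 else 0 := by
    intro b i
    split_ifs <;> simp
  -- Downward induction, since the dependent entries of `V_k` are computed from the matrix of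
  -- `V_{k+1}`.
  induction hk using Nat.decreasingInduction with
  | self =>
    intro i hi b
    rw [polyMatrix_last, lastMatrix]
    split_ifs with h1 h2 h3 h4
    · rw [hR.reduced n le_rfl i hi b h1, if_pos h2, map_one]
    · rw [hR.reduced n le_rfl i hi b h1, if_neg h2, map_zero]
    -- A dependent entry: the relation for the rows `i` and `dual b` expresses it through the free
    -- entry `(dual b, dual i)`.
    · have hl := hR.lagrangian i hi (dual b) ((dual_mem_col_iff hI b).2 h1)
      rw [dual_dual] at hl
      rw [map_mul, MvPolynomial.eval_C, hvar (mem_freeEntries_dual hI hi h1 h3 h4),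
        mul_comm (eps i), mul_assoc, hl, ← mul_assoc, eps_mul_self, one_mul]
    · rw [hvar ((mem_freeEntries_last I).2 ⟨hi, h1, h3, h4⟩)]
    · rw [hR.lower n le_rfl i hi b h1 h3, map_zero]
  | of_succ k hk ih =>
    intro i hi b
    have hent : ∀ j ∉ col I k, (j ∈ col I (k + 1) ∨ (j : ℕ) = k + 1) →
        R k i j = MvPolynomial.eval y (entryVar I k i j) := by
      intro j hj hj'
      by_cases hlt : Lt k j i
      · rw [hvar ((mem_freeEntries_of_lt I hk).2 ⟨hi, hj, hlt, hj'⟩)]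
      · rw [hvar' (fun h => hlt ((mem_freeEntries_of_lt I hk).1 h).2.2.1),
          hR.lower k hk.le i hi j hj hlt]
    rw [polyMatrix_of_lt I hk, stepMatrix]
    split_ifs with h1 h2 h3
    · rw [hR.reduced k hk.le i hi b h1, if_pos h2, map_one]
    · rw [hR.reduced k hk.le i hi b h1, if_neg h2, map_zero]
    · exact hent b h1 h3
    · rw [not_or] at h3
      rw [hR.step k hk i hi b h3.1 h3.2, map_sum]
      refine Finset.sum_congr rfl fun j hj => ?_
      rw [Finset.mem_filter] at hj
      rw [map_mul, ← ih j hj.1 b]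
      congr 1
      split_ifs with h4 h5
      · rw [hR.reduced k hk.le i hi j h4, if_pos h5, map_one]
      · rw [hR.reduced k hk.le i hi j h4, if_neg h5, map_zero]
      · exact hent j h4 (Or.inl hj.1)

/-- The matrices with prescribed free entries. -/
noncomputable def solution (I : Coll n (2 * n)) (y : {t // t ∈ freeEntries I} → ℂ) (k : ℕ)
    (i b : Idx (2 * n)) : ℂ :=
  MvPolynomial.eval y (polyMatrix I k i b)

theorem eval_entryVar (y : {t // t ∈ freeEntries I} → ℂ) {k : ℕ} {i b : Idx (2 * n)}
    (h : (k, i, b) ∈ freeEntries I) : MvPolynomial.eval y (entryVar I k i b) = y ⟨_, h⟩ := by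
  rw [entryVar, dif_pos h, MvPolynomial.eval_X]

theorem solution_freeEntries (y : {t // t ∈ freeEntries I} → ℂ) (t : {t // t ∈ freeEntries I}) :
    solution I y t.1.1 t.1.2.1 t.1.2.2 = y t := by
  obtain ⟨⟨k, i, b⟩, ht⟩ := t
  have hk : k ≤ n := by
    have := (Finset.mem_product.1 (Finset.mem_filter.1 ht).1).1
    exact Nat.lt_succ_iff.1 (Finset.mem_range.1 this)
  rw [solution]
  rcases hk.eq_or_lt with rfl | hk
  · obtain ⟨-, h2, h3, h4⟩ := (mem_freeEntries_last I).1 ht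
    rw [polyMatrix_last, lastMatrix, if_neg h2, if_pos h3, if_neg h4, eval_entryVar y ht]
  · obtain ⟨-, h2, h3, h4⟩ := (mem_freeEntries_of_lt I hk).1 ht
    rw [polyMatrix_of_lt I hk, stepMatrix, if_neg h2, if_pos h4, eval_entryVar y ht]

theorem solution_isReduced (y : {t // t ∈ freeEntries I} → ℂ) {k : ℕ} (hk : k ≤ n) :
    IsReduced (col I k) (solution I y k) := by
  intro i _ b hb
  rw [solution]
  rcases hk.eq_or_lt with rfl | hk
  · rw [polyMatrix_last, lastMatrix, if_pos hb]
    split_ifs <;> simp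
  · rw [polyMatrix_of_lt I hk, stepMatrix, if_pos hb]
    split_ifs <;> simp

theorem solution_step (hI : I ∈ admissible n) (y : {t // t ∈ freeEntries I} → ℂ) {k : ℕ}
    (hk : k < n) {i : Idx (2 * n)} {b : Idx (2 * n)}
    (hb : b ∉ col I (k + 1)) (hbk : (b : ℕ) ≠ k + 1) :
    solution I y k i b =
      ∑ j ∈ (col I (k + 1)).filter (fun j : Idx (2 * n) => (j : ℕ) ≠ k + 1),
        solution I y k i j * solution I y (k + 1) j b := by
  have hbk' : b ∉ col I k := fun h => (mem_col_succ hI hk h).elim hb hbk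
  conv_lhs => rw [solution, polyMatrix_of_lt I hk, stepMatrix, if_neg hbk',
    if_neg (not_or.2 ⟨hb, hbk⟩), map_sum]
  refine Finset.sum_congr rfl fun j hj => ?_
  rw [map_mul]
  refine congrArg (· * _) ?_
  rw [solution, polyMatrix_of_lt I hk, stepMatrix,
    if_pos (Or.inl (Finset.mem_filter.1 hj).1 : j ∈ col I (k + 1) ∨ (j : ℕ) = k + 1)]

/-- Triangularity of the dependent entries has to be checked. A nonzero term of the step equation
would need `b <_k j`, together with `j <_k i` or `j = i`, hence `b <_k i` by transitivity. -/
theorem solution_isLower (hI : I ∈ admissible n) (y : {t // t ∈ freeEntries I} → ℂ) {k : ℕ}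
    (hk : k ≤ n) : IsLower k (col I k) (solution I y k) := by
  induction hk using Nat.decreasingInduction with
  | self =>
    intro i _ b hb hlt
    rw [solution, polyMatrix_last, lastMatrix, if_neg hb, if_neg hlt, map_zero]
  | of_succ k hk ih =>
    intro i hi b hb hlt
    have hent : ∀ j ∉ col I k, (j ∈ col I (k + 1) ∨ (j : ℕ) = k + 1) → ¬ Lt k j i →
        solution I y k i j = 0 := by
      intro j hj hj' hlt
      rw [solution, polyMatrix_of_lt I hk, stepMatrix, if_neg hj, if_pos hj', entryVar,
        dif_neg fun h => hlt ((mem_freeEntries_of_lt I hk).1 h).2.2.1, map_zero]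
    by_cases hbJ : b ∈ col I (k + 1) ∨ (b : ℕ) = k + 1
    · exact hent b hb hbJ hlt
    · rw [not_or] at hbJ
      rw [solution_step hI y hk hbJ.1 hbJ.2]
      refine Finset.sum_eq_zero fun j hj => ?_
      rw [Finset.mem_filter] at hj
      by_cases hjb : Lt (k + 1) b j
      · rw [lt_succ_iff hbJ.2 hj.2] at hjb
        have hji : ¬ Lt k j i := fun h => hlt (hjb.trans h)
        by_cases hjc : j ∈ col I k
        · rw [solution_isReduced y hk.le i hi j hjc, if_neg, zero_mul]
          rintro rfl
          exact hlt hjb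
        · rw [hent j hjc (Or.inl hj.1) hji, zero_mul]
      · rw [ih j hj.1 b hbJ.1 hjb, mul_zero]

theorem solution_isSolution (hI : I ∈ admissible n) (y : {t // t ∈ freeEntries I} → ℂ) :
    IsSolution I (solution I y) where
  reduced k hk := solution_isReduced y hk
  lower k hk := solution_isLower hI y hk
  step k hk i _ b hb hbk := solution_step hI y hk hb hbk
  lagrangian := by
    have key : ∀ i ∈ col I n, ∀ i' ∈ col I n, Lt n i' i →
        eps i * solution I y n i' (dual i) = eps i' * solution I y n i (dual i') := by
      intro i hi i' hi' hlt
      have h1 : dual i ∉ col I n := fun h => (dual_mem_col_iff hI i).1 h hi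
      have h2 : dual i' ∉ col I n := fun h => (dual_mem_col_iff hI i').1 h hi'
      by_cases h : Lt n (dual i') i
      · have h' : Lt n (dual i) i' := lt_dual_iff.1 h
        rw [solution, solution, polyMatrix_last, lastMatrix, lastMatrix, if_neg h1, if_neg h2,
          if_pos h, if_pos h', dual_dual, dual_dual, if_pos hlt, if_neg hlt.asymm, map_mul,
          MvPolynomial.eval_C, ← mul_assoc, mul_comm (eps i) (eps i'), ← mul_assoc, eps_mul_self,
          one_mul]
      · have h' : ¬ Lt n (dual i) i' := fun h' => h (lt_dual_iff.1 h')
        rw [solution_isLower hI y le_rfl i' hi' _ h1 h', solution_isLower hI y le_rfl i hi _ h2 h,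
          mul_zero, mul_zero]
    intro i hi i' hi'
    by_cases h : (i : ℕ) = i'
    · rw [Subtype.ext h]
    · rcases Lt.total (k := n) h with h | h
      · exact (key i' hi' i hi h).symm
      · exact key i hi i' hi' h

end Parametrization

/-! ### Affine charts of the product of Grassmannians -/

theorem continuous_polyMap {σ τ : Type} (F : τ → MvPolynomial σ ℂ) :
    Continuous (X := ZSpace σ) (Y := ZSpace τ) fun y t => MvPolynomial.eval y (F t) := by
  refine (isTopologicalBasis_basicOpen τ).continuous_iff.2 ?_
  rintro _ ⟨p, rfl⟩
  convert! isOpen_basicOpen (MvPolynomial.bind₁ F p) using 1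
  ext y
  have h : ∀ y : σ → ℂ, MvPolynomial.eval y (MvPolynomial.bind₁ F p) =
      MvPolynomial.eval (fun t => MvPolynomial.eval y (F t)) p := fun y => by
    simp only [← MvPolynomial.aeval_eq_eval, MvPolynomial.aeval_bind₁]
  exact iff_of_eq (congrArg (· ≠ 0) (h y).symm)

/-- The index set of the entries of a tuple of matrices. -/
abbrev Entries (n N : ℕ) : Type := Σ k : Idx n, Fin (k : ℕ) × Idx N

/-- The entries of a tuple of full rank matrices, as a point of affine space. -/
def Frames.toZSpace {n N : ℕ} (x : Frames n N) : ZSpace (Entries n N) := x.1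

instance (n N : ℕ) : TopologicalSpace (Frames n N) :=
  TopologicalSpace.induced Frames.toZSpace inferInstance

theorem Frames.continuous_span {n N : ℕ} : Continuous (Frames.span : Frames n N → GrProd n N) :=
  continuous_coinduced_rng

theorem GrProd.isOpen_iff {n N : ℕ} {s : Set (GrProd n N)} :
    IsOpen s ↔ IsOpen (Frames.span ⁻¹' s) := isOpen_coinduced

section Chart

variable {n N : ℕ} (c : ∀ k : Idx n, Fin (k : ℕ) → Idx N)

/-- The square submatrices on the columns `c`. -/
def MatTuple.minorMatrix {R : Type} (x : Entries n N → R) (k : Idx n) :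
    Matrix (Fin (k : ℕ)) (Fin (k : ℕ)) R :=
  Matrix.of fun i j => x ⟨k, i, c k j⟩

/-- The tuples of matrices which are the identity on the columns `c`. -/
def MatTuple.IsUnitOn (x : MatTuple n N) : Prop := ∀ k, MatTuple.minorMatrix c x k = 1

/-- The normalization of a tuple of matrices with invertible submatrices on the columns `c`. -/
noncomputable def MatTuple.normalize (x : MatTuple n N) : MatTuple n N := fun t =>
  ((MatTuple.minorMatrix c x t.1).det)⁻¹ *
    ∑ j, (MatTuple.minorMatrix c x t.1).adjugate t.2.1 j * x ⟨t.1, j, t.2.2⟩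

variable {c}

theorem MatTuple.IsUnitOn.apply {x : MatTuple n N} (hx : x.IsUnitOn c) (k : Idx n)
    (i j : Fin (k : ℕ)) : x ⟨k, i, c k j⟩ = if i = j then 1 else 0 := by
  have := congrFun (congrFun (hx k) i) j
  rwa [Matrix.one_apply] at this

theorem MatTuple.IsUnitOn.linearIndependent {x : MatTuple n N} (hx : x.IsUnitOn c) (k : Idx n) :
    LinearIndependent ℂ (x.row k) := by
  rw [Fintype.linearIndependent_iff]
  intro g hg j
  have := congrFun hg (c k j)
  rw [Finset.sum_apply, Finset.sum_eq_single j] at this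
  · simpa [MatTuple.row, hx.apply] using this
  · intro i _ hij
    simp [MatTuple.row, hx.apply, hij]
  · simp

theorem MatTuple.normalize_eq_sum (x : MatTuple n N) (k : Idx n) (i : Fin (k : ℕ)) (b : Idx N) :
    x.normalize c ⟨k, i, b⟩ = ∑ j, (MatTuple.minorMatrix c x k)⁻¹ i j * x ⟨k, j, b⟩ := by
  simp [MatTuple.normalize, Matrix.inv_def, Finset.mul_sum, mul_assoc]

theorem MatTuple.normalize_isUnitOn {x : MatTuple n N}
    (hx : ∀ k, (MatTuple.minorMatrix c x k).det ≠ 0) : (x.normalize c).IsUnitOn c := by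
  intro k
  rw [← Matrix.nonsing_inv_mul _ (isUnit_iff_ne_zero.2 (hx k))]
  ext i j
  exact x.normalize_eq_sum k i (c k j)

theorem MatTuple.row_normalize_mem (x : MatTuple n N) (k : Idx n) (i : Fin (k : ℕ)) :
    (x.normalize c).row k i ∈ Submodule.span ℂ (Set.range (x.row k)) := by
  have : (x.normalize c).row k i =
      ∑ j, (MatTuple.minorMatrix c x k)⁻¹ i j • x.row k j := by
    funext b
    rw [Finset.sum_apply]
    exact x.normalize_eq_sum k i b
  rw [this]
  exact Submodule.sum_mem _ fun j _ =>
    Submodule.smul_mem _ _ (Submodule.subset_span ⟨j, rfl⟩)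

/-- A frame which is the identity on the columns `c` is the normalization of each frame with the
same row spaces. -/
theorem MatTuple.IsUnitOn.eq_normalize {x y : Frames n N} (hx : x.1.IsUnitOn c)
    (h : x.span = y.span) :
    (∀ k, (MatTuple.minorMatrix c y.1 k).det ≠ 0) ∧ x.1 = y.1.normalize c := by
  have hex : ∀ k : Idx n, ∃ H : Matrix (Fin (k : ℕ)) (Fin (k : ℕ)) ℂ,
      ∀ i b, x.1 ⟨k, i, b⟩ = ∑ j, H i j * y.1 ⟨k, j, b⟩ := by
    intro k
    have hk : Submodule.span ℂ (Set.range (x.1.row k)) =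
        Submodule.span ℂ (Set.range (y.1.row k)) := congrArg Subtype.val (congrFun h k)
    have hmem : ∀ i, ∃ g : Fin (k : ℕ) → ℂ, ∑ j, g j • y.1.row k j = x.1.row k i := by
      intro i
      rw [← Submodule.mem_span_range_iff_exists_fun, ← hk]
      exact Submodule.subset_span ⟨i, rfl⟩
    choose H hH using hmem
    refine ⟨Matrix.of H, fun i b => ?_⟩
    have := congrFun (hH i) b
    rw [Finset.sum_apply] at this
    exact this.symm
  choose H hH using hex
  have hmul : ∀ k, H k * MatTuple.minorMatrix c y.1 k = 1 := by
    intro k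
    rw [← hx k]
    ext i j
    exact (hH k i (c k j)).symm
  refine ⟨fun k hk => ?_, ?_⟩
  · have := congrArg Matrix.det (hmul k)
    rw [Matrix.det_mul, hk, mul_zero, Matrix.det_one] at this
    exact zero_ne_one this
  · funext ⟨k, i, b⟩
    rw [MatTuple.normalize_eq_sum, hH, Matrix.inv_eq_left_inv (hmul k)]

theorem MatTuple.IsUnitOn.eq_of_span_eq {x y : Frames n N} (hx : x.1.IsUnitOn c)
    (hy : y.1.IsUnitOn c) (h : x.span = y.span) : x = y :=
  Subtype.ext ((hx.eq_normalize h).2.trans (hy.eq_normalize rfl).2.symm)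

variable (c) in
/-- The product of the minors on the columns `c`. -/
noncomputable def minorProd : MvPolynomial (Entries n N) ℂ :=
  ∏ k, (MatTuple.minorMatrix c MvPolynomial.X k).det

theorem eval_det_minorMatrix (x : MatTuple n N) (k : Idx n) :
    MvPolynomial.eval x (MatTuple.minorMatrix c MvPolynomial.X k).det =
      (MatTuple.minorMatrix c x k).det := by
  rw [RingHom.map_det]
  congr 1
  ext i j
  simp [MatTuple.minorMatrix]

theorem eval_adjugate_minorMatrix (x : MatTuple n N) (k : Idx n) (i j : Fin (k : ℕ)) :
    MvPolynomial.eval x ((MatTuple.minorMatrix c MvPolynomial.X k).adjugate i j) =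
      (MatTuple.minorMatrix c x k).adjugate i j := by
  have h : (MvPolynomial.eval x).mapMatrix (MatTuple.minorMatrix c MvPolynomial.X k) =
      MatTuple.minorMatrix c x k := by
    ext i j
    simp [MatTuple.minorMatrix]
  rw [← h, ← RingHom.map_adjugate]
  rfl

theorem eval_minorProd (x : MatTuple n N) :
    MvPolynomial.eval x (minorProd c) = ∏ k, (MatTuple.minorMatrix c x k).det := by
  simp only [minorProd, map_prod, eval_det_minorMatrix]

theorem eval_minorProd_ne_zero {x : MatTuple n N} :
    MvPolynomial.eval x (minorProd c) ≠ 0 ↔ ∀ k, (MatTuple.minorMatrix c x k).det ≠ 0 := by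
  rw [eval_minorProd, Finset.prod_ne_zero_iff]
  simp

variable (c) in
/-- Polynomials in the normalized entries are fractions whose denominator is a power of the
product of the minors. -/
theorem exists_eval_normalize_eq (p : MvPolynomial (Entries n N) ℂ) :
    ∃ (P : MvPolynomial (Entries n N) ℂ) (m : ℕ), ∀ x : MatTuple n N,
      MvPolynomial.eval x (minorProd c) ≠ 0 →
      MvPolynomial.eval (x.normalize c) p * MvPolynomial.eval x (minorProd c) ^ m =
        MvPolynomial.eval x P := by
  induction p using MvPolynomial.induction_on with
  | C a => exact ⟨MvPolynomial.C a, 0, fun x _ => by simp⟩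
  | add p q hp hq =>
    obtain ⟨P, m, hP⟩ := hp
    obtain ⟨Q, l, hQ⟩ := hq
    refine ⟨P * minorProd c ^ l + Q * minorProd c ^ m, m + l, fun x hx => ?_⟩
    rw [map_add, map_add, map_mul, map_mul, map_pow, map_pow, ← hP x hx, ← hQ x hx]
    ring
  | mul_X p t hp =>
    obtain ⟨P, m, hP⟩ := hp
    obtain ⟨k, i, b⟩ := t
    refine ⟨P * ((∏ k' ∈ Finset.univ.erase k,
      (MatTuple.minorMatrix c MvPolynomial.X k').det) *
      ∑ j, (MatTuple.minorMatrix c MvPolynomial.X k).adjugate i j *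
        MvPolynomial.X ⟨k, j, b⟩), m + 1, fun x hx => ?_⟩
    have hk := eval_minorProd_ne_zero.1 hx k
    have hD : MvPolynomial.eval x (minorProd c) = (MatTuple.minorMatrix c x k).det *
        ∏ k' ∈ Finset.univ.erase k, (MatTuple.minorMatrix c x k').det := by
      rw [eval_minorProd, Finset.mul_prod_erase _
        (fun k => (MatTuple.minorMatrix c x k).det) (Finset.mem_univ k)]
    simp only [map_mul, map_prod, map_sum, eval_det_minorMatrix, eval_adjugate_minorMatrix,
      MvPolynomial.eval_X]
    -- Only the one additional factor of the product of minors is expanded, so that its `k`-th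
    -- determinant cancels the inverse determinant in the normalized entry.
    rw [← hP x hx, pow_succ]
    nth_rewrite 2 [hD]
    rw [MatTuple.normalize]
    field_simp

variable (c) in
/-- The locus in an affine chart where a polynomial in the normalized entries is nonzero. -/
def chartOpen (p : MvPolynomial (Entries n N) ℂ) : Set (GrProd n N) :=
  {V | ∃ x : Frames n N, x.1.IsUnitOn c ∧ x.span = V ∧ MvPolynomial.eval x.1 p ≠ 0}

/-- Pulls the condition back to frames, where openness in the quotient topology is tested; the unit
frame of a point of the chart is unique, namely the normalization of any frame of it. -/
theorem span_mem_chartOpen_iff {p : MvPolynomial (Entries n N) ℂ} {y : Frames n N} :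
    y.span ∈ chartOpen c p ↔ MvPolynomial.eval y.1 (minorProd c) ≠ 0 ∧
      MvPolynomial.eval (y.1.normalize c) p ≠ 0 := by
  constructor
  · rintro ⟨x, hx, hxy, hp⟩
    obtain ⟨h1, h2⟩ := hx.eq_normalize hxy
    exact ⟨eval_minorProd_ne_zero.2 h1, h2 ▸ hp⟩
  · rintro ⟨h1, h2⟩
    have hu := MatTuple.normalize_isUnitOn (eval_minorProd_ne_zero.1 h1)
    refine ⟨⟨y.1.normalize c, hu.linearIndependent⟩, hu, ?_, h2⟩
    funext k
    apply Subtype.ext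
    refine Submodule.eq_of_le_of_finrank_eq ?_ ?_
    · refine Submodule.span_le.2 ?_
      rintro _ ⟨i, rfl⟩
      exact y.1.row_normalize_mem k i
    · exact (Frames.span _ k).2.trans (y.span k).2.symm

variable (c) in
theorem isOpen_chartOpen (p : MvPolynomial (Entries n N) ℂ) : IsOpen (chartOpen c p) := by
  obtain ⟨P, m, hP⟩ := exists_eval_normalize_eq c p
  -- Where the minors do not vanish, `P` is the value of `p` at the normalized entries times a power
  -- of a nonzero number, so both have the same nonvanishing locus.
  have h : Frames.span ⁻¹' chartOpen c p = Frames.toZSpace ⁻¹' basicOpen (minorProd c * P) := by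
    ext y
    refine span_mem_chartOpen_iff.trans (Iff.trans ?_ mem_basicOpen_mul.symm)
    refine and_congr_right fun h => Iff.trans ?_ mem_basicOpen.symm
    rw [Frames.toZSpace, ← hP y.1 h]
    exact ⟨fun h' => mul_ne_zero h' (pow_ne_zero _ h), left_ne_zero_of_mul⟩
  rw [GrProd.isOpen_iff, h]
  exact (isOpen_basicOpen _).preimage continuous_induced_dom

end Chart

/-! ### The cell is an affine space -/

section Cell

variable {n : ℕ} {I : Coll n (2 * n)}

/-- An enumeration of the columns `I_k`. -/
noncomputable def colEnum (hI : I ∈ admissible n) (k : Idx n) :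
    Fin (k : ℕ) ≃ {i // i ∈ col I k} :=
  ((col I k).equivFinOfCardEq (card_col hI k.le)).symm

/-- The columns `I_k` as a choice of minors. -/
noncomputable def pivots (hI : I ∈ admissible n) (k : Idx n) (j : Fin (k : ℕ)) : Idx (2 * n) :=
  (colEnum hI k j).1

/-- The reduced matrices of a point of the cell as polynomials in the free entries. -/
noncomputable def cellPoly (hI : I ∈ admissible n) (t : Entries n (2 * n)) :
    MvPolynomial {t // t ∈ freeEntries I} ℂ :=
  polyMatrix I t.1 (pivots hI t.1 t.2.1) t.2.2

/-- The tuple of reduced matrices with given free entries. -/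
noncomputable def cellMatrix (hI : I ∈ admissible n) (y : {t // t ∈ freeEntries I} → ℂ) :
    MatTuple n (2 * n) := fun t => MvPolynomial.eval y (cellPoly hI t)

theorem cellMatrix_isUnitOn (hI : I ∈ admissible n) (y : {t // t ∈ freeEntries I} → ℂ) :
    (cellMatrix hI y).IsUnitOn (pivots hI) := by
  intro k
  ext i j
  refine (solution_isReduced y k.le _ (colEnum hI k i).2 _ (colEnum hI k j).2).trans ?_
  rw [Matrix.one_apply]
  refine if_congr ?_ rfl rfl
  rw [← Subtype.ext_iff, (colEnum hI k).injective.eq_iff, eq_comm]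

/-- The frame with given free entries. -/
noncomputable def cellFrame (hI : I ∈ admissible n) (y : {t // t ∈ freeEntries I} → ℂ) :
    Frames n (2 * n) :=
  ⟨cellMatrix hI y, (cellMatrix_isUnitOn hI y).linearIndependent⟩

theorem cellFrame_span_sub (hI : I ∈ admissible n) (y : {t // t ∈ freeEntries I} → ℂ)
    (k : Idx n) : (cellFrame hI y).span.sub k = rowSpan (col I k) (solution I y k) := by
  have h : (cellMatrix hI y).row k =
      (fun i : {i // i ∈ col I k} => (solution I y k i : E (2 * n))) ∘ colEnum hI k := rfl
  refine congrArg (Submodule.span ℂ) ?_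
  refine (congrArg Set.range h).trans ?_
  exact (colEnum hI k).surjective.range_comp _

theorem cellFrame_span_mem (hI : I ∈ admissible n) (y : {t // t ∈ freeEntries I} → ℂ) :
    (cellFrame hI y).span ∈ cell I :=
  (mem_cell_iff hI).2 ⟨_, solution_isSolution hI y, cellFrame_span_sub hI y⟩

/-- Each parameter is literally an entry of the normalized frame. This gives injectivity of the
parametrization and a polynomial inverse. -/
theorem exists_cellMatrix_eq (hI : I ∈ admissible n) (t : {t // t ∈ freeEntries I}) :
    ∃ u : Entries n (2 * n), ∀ y, cellMatrix hI y u = y t := by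
  obtain ⟨⟨k, i, b⟩, ht⟩ := t
  have hmem := Finset.mem_filter.1 ht
  have hk : k ≤ n :=
    Nat.lt_succ_iff.1 (Finset.mem_range.1 (Finset.mem_product.1 hmem.1).1)
  have hi : i ∈ col I k := hmem.2.1
  have h0 : 1 ≤ k := by
    rcases Nat.eq_zero_or_pos k with rfl | h0
    · simp [col_zero] at hi
    · exact h0
  let k' : Idx n := ⟨k, Finset.mem_Icc.2 ⟨h0, hk⟩⟩
  refine ⟨⟨k', (colEnum hI k').symm ⟨i, hi⟩, b⟩, fun y => ?_⟩
  have hp : pivots hI k' ((colEnum hI k').symm ⟨i, hi⟩) = i := by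
    rw [pivots, Equiv.apply_symm_apply]
  have := solution_freeEntries y ⟨(k, i, b), ht⟩
  rw [← this]
  change solution I y k (pivots hI k' _) b = _
  rw [hp]

/-- The parametrization of the cell by its free entries. -/
noncomputable def cellMap (hI : I ∈ admissible n) (y : ZSpace {t // t ∈ freeEntries I}) :
    cell I :=
  ⟨(cellFrame hI y).span, cellFrame_span_mem hI y⟩

theorem continuous_cellMap (hI : I ∈ admissible n) : Continuous (cellMap hI) :=
  Continuous.subtype_mk (Frames.continuous_span.comp
    (continuous_induced_rng.2 (continuous_polyMap (cellPoly hI)))) _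

theorem cellMap_injective (hI : I ∈ admissible n) : Function.Injective (cellMap hI) := by
  intro y y' h
  have h' : cellFrame hI y = cellFrame hI y' :=
    (cellMatrix_isUnitOn hI y).eq_of_span_eq (cellMatrix_isUnitOn hI y') (congrArg Subtype.val h)
  funext t
  obtain ⟨u, hu⟩ := exists_cellMatrix_eq hI t
  rw [← hu y, ← hu y']
  exact congrFun (congrArg Subtype.val h') u

theorem cellMap_surjective (hI : I ∈ admissible n) : Function.Surjective (cellMap hI) := by
  rintro ⟨V, hV⟩
  obtain ⟨R, hR, hVR⟩ := (mem_cell_iff hI).1 hV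
  let y : {t // t ∈ freeEntries I} → ℂ := fun t => R t.1.1 t.1.2.1 t.1.2.2
  refine ⟨y, Subtype.ext (funext fun k => Subtype.ext ?_)⟩
  refine (cellFrame_span_sub hI y k).trans (Eq.trans ?_ (hVR k).symm)
  have : (fun i : {i // i ∈ col I k} => (solution I y k i : E (2 * n))) =
      fun i : {i // i ∈ col I k} => R k i.1 := by
    funext i b
    exact (hR.eq_eval hI k.le i.1 i.2 b).symm
  rw [rowSpan, rowSpan, this]

/-- A polynomial in the parameters becomes, after renaming variables, a polynomial in the normalized
entries; the image of its nonvanishing locus is therefore the trace on the cell of a `chartOpen`. -/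
theorem isOpenMap_cellMap (hI : I ∈ admissible n) : IsOpenMap (cellMap hI) := by
  choose u hu using exists_cellMatrix_eq hI
  refine (isTopologicalBasis_basicOpen _).isOpenMap_iff.2 ?_
  rintro _ ⟨p, rfl⟩
  have heval : ∀ y : {t // t ∈ freeEntries I} → ℂ,
      MvPolynomial.eval (cellMatrix hI y) (MvPolynomial.rename u p) = MvPolynomial.eval y p := by
    intro y
    rw [MvPolynomial.eval_rename]
    congr 2
    funext t
    exact hu t y
  have h : cellMap hI '' basicOpen p =
      Subtype.val ⁻¹' chartOpen (pivots hI) (MvPolynomial.rename u p) := by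
    ext V
    obtain ⟨y, rfl⟩ := cellMap_surjective hI V
    rw [(cellMap_injective hI).mem_set_image]
    constructor
    · intro hy
      refine ⟨cellFrame hI y, cellMatrix_isUnitOn hI y, rfl, ?_⟩
      exact fun h0 => hy ((heval y).symm.trans h0)
    · rintro ⟨x, hx, hxy, hp⟩
      have hx' : x = cellFrame hI y := hx.eq_of_span_eq (cellMatrix_isUnitOn hI y) hxy
      rw [hx'] at hp
      exact fun h0 => hp ((heval y).trans h0)
  rw [h]
  exact (isOpen_chartOpen _ _).preimage continuous_subtype_val

/-- The cell is homeomorphic to an affine space. -/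
theorem isHomeomorph_cellMap (hI : I ∈ admissible n) : IsHomeomorph (cellMap hI) :=
  ⟨continuous_cellMap hI, isOpenMap_cellMap hI, cellMap_injective hI, cellMap_surjective hI⟩

theorem topologicalKrullDim_cell (hI : I ∈ admissible n) :
    topologicalKrullDim (cell I) = (((freeEntries I).card : ℕ∞) : WithBot ℕ∞) := by
  rw [← (isHomeomorph_cellMap hI).topologicalKrullDim_eq, topologicalKrullDim_zspace,
    Nat.card_eq_fintype_card, Fintype.card_coe]

end Cell

end DegFlag

theorem mainTheorem8 (n : ℕ) (I : DegFlag.Coll n (2 * n)) (hI : I ∈ DegFlag.admissible n) :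
    (∃ m : ℕ, (m : ℤ) = DegFlag.d I n ∧
      topologicalKrullDim (DegFlag.cell I) = ((m : ℕ∞) : WithBot ℕ∞)) ∧
    ∀ k ∈ Finset.Icc 1 n,
      DegFlag.d I k = DegFlag.d I (k - 1) +
        ∑ l ∈ DegFlag.initiating I k,
          (DegFlag.white I k l -
            ∑ l' ∈ (DegFlag.col I k).filter
                (fun l' : DegFlag.Idx (2 * n) => DegFlag.Lt k l' l ∨ l' ∉ DegFlag.initiating I k),
              DegFlag.s l l' k) := by
  refine ⟨⟨(DegFlag.freeEntries I).card, ?_, DegFlag.topologicalKrullDim_cell hI⟩, fun k hk => ?_⟩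
  · rw [DegFlag.d_last hI, DegFlag.card_freeEntries]
  · obtain ⟨h0, hk⟩ := Finset.mem_Icc.1 hk
    obtain ⟨k, rfl⟩ : ∃ j, k = j + 1 := ⟨k - 1, by omega⟩
    rw [DegFlag.d, DegFlag.increment_eq_diskSum hI hk, DegFlag.diskSum, Nat.add_sub_cancel]
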